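/- Let $f(z)=\lambda e^{z}$ with $\lambda\in\mathbb C\setminus\{0\}$ have an attracting periodic cycle $z_0,z_1=f(z_0),\dots,z_p=z_0$ of exact period $p>1$. Let $J(f)$ be the Julia set (the set of points having no neighbourhood on which the iterates of $f$ form a normal family), and let $I(f)=\{z\in\mathbb C: f^n(z)\to\infty\}$. Let $U_j$ be the component of the basin of attraction of the cycle that contains $z_j$, where the cycle is labelled so that $0\in U_1$. Let $B_{p+1}\subset U_1$ be a bounded simply connected domain with $0,z_1\in B_{p+1}$, whose boundary is a Jordan curve in $U_1$, and such that $\overline{f^p(B_{p+1})}\subset B_{p+1}$. Put $B_p=f^{-1}(B_{p+1})$. Let $C_p\subset B_p$ be a domain containing $z_0$ and some left half-plane, such that $\partial C_p$ is a curve homeomorphic to the real line whose two ends have imaginary parts tending to $+\infty$ and $-\infty$ respectively, $\partial C_p$ coincides with $\partial B_p$ on $\{|\operatorname{Im} z|<L_1\}$, and $\partial C_p$ is vertical on $\{|\operatorname{Im} z|>L_2\}$ (a vertical half-line both in $\{\operatorname{Im} z>L_2\}$ and in $\{\operatorname{Im} z<-L_2\}$). Here $L_1,L_2>0$ and $L_1$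 is so large that $|\operatorname{Im} f^{p-1}(w)|<L_1$ for all $w\in\overline{B_{p+1}}$. For $j=p-1,\dots,0$ let $C_j$ be the component of $f^{-1}(C_{j+1})$ containing $z_j$. Let $\mathcal H_0$ be any component of $\mathbb C\setminus C_0$ and put $\mathcal H_s=\mathcal H_0+2\pi i s$ for $s\in\mathbb Z$ (these are exactly the components of $\mathbb C\setminus C_0$). For $1\le j\le p-1$ let $k_j$ be the integer with $z_j\in\mathcal H_{k_j}$. A point $z$ has itinerary $(s_0,s_1,\dots)\in\mathbb Z^{\mathbb N}$ if $f^n(z)\in\mathcal H_{s_n}$ for all $n\ge 0$. Let $\underline k=(k_1,\dots,k_{p-1})$ and $$\Sigma_{\underline k}=\{(t_0,\underline k,t_1,\underline k,t_2,\dots): t_0,t_1,t_2,\dots\in\mathbb Z\}.$$ Then, for every such choice, the Hausdorff dimension of the set $$\{z\in J(f): z\text{ has itinerary in }\Sigma_{\underline k}\}\cap I(f)$$ is equal to $1$. -/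

import Mathlib

open Set Filter Topology

namespace ExpBasin

/-- The exponential map `f(z) = lam * exp z`. -/
noncomputable def expMap (lam : ℂ) : ℂ → ℂ := fun z => lam * Complex.exp z

/-- The iterates of `f` form a normal family on `V`: every sequence of iterates has a subsequence
which, locally uniformly on `V`, converges to a finite function or tends to `∞`. -/
def NormalIteratesOn (f : ℂ → ℂ) (V : Set ℂ) : Prop :=
  ∀ u : ℕ → ℕ, ∃ φ : ℕ → ℕ, StrictMono φ ∧
    ((∃ g : ℂ → ℂ, TendstoLocallyUniformlyOn (fun n => f^[u (φ n)]) g atTop V) ∨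
      (∀ K : Set ℂ, K ⊆ V → IsCompact K → ∀ R : ℝ, ∀ᶠ n in atTop, ∀ w ∈ K,
        R ≤ ‖f^[u (φ n)] w‖))

/-- The Fatou set: points with an open neighbourhood on which the iterates are a normal family. -/
def fatouSet (f : ℂ → ℂ) : Set ℂ :=
  {z | ∃ V : Set ℂ, IsOpen V ∧ z ∈ V ∧ NormalIteratesOn f V}

/-- The Julia set `J(f)`. -/
def juliaSet (f : ℂ → ℂ) : Set ℂ := (fatouSet f)ᶜ

/-- The escaping set `I(f)`: points whose forward orbit tends to `∞`. -/
def escapingSet (f : ℂ → ℂ) : Set ℂ :=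
  {z | Tendsto (fun n => f^[n] z) atTop (Bornology.cobounded ℂ)}

/-- `z₀` is an attracting periodic point of exact period `p` (used for `p ≥ 1` only). -/
def IsAttractingPeriodicPt (f : ℂ → ℂ) (p : ℕ) (z₀ : ℂ) : Prop :=
  Function.minimalPeriod f z₀ = p ∧ ‖deriv (f^[p]) z₀‖ < 1

/-- The entire basin of attraction of the cycle of `z₀`: points whose orbit under `f^p` converges
to some point of the cycle. -/
def basin (f : ℂ → ℂ) (p : ℕ) (z₀ : ℂ) : Set ℂ :=
  {w | ∃ j : ℕ, Tendsto (fun n => f^[p * n] w) atTop (𝓝 (f^[j] z₀))}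

/-- `U_j`: the component of the basin containing `z_j = f^j(z₀)`. -/
def basinComponent (f : ℂ → ℂ) (p : ℕ) (z₀ : ℂ) (j : ℕ) : Set ℂ :=
  connectedComponentIn (basin f p z₀) (f^[j] z₀)

/-- An admissible choice of the domain `B_{p+1} = D`: a bounded simply connected domain, whose
boundary is a Jordan curve in `U_1`, with `0, z_1 ∈ D ⊆ U_1` and `closure (f^p(D)) ⊆ D`. -/
structure IsInitialDomain (f : ℂ → ℂ) (p : ℕ) (z₀ : ℂ) (D : Set ℂ) : Prop where
  isOpen : IsOpen D
  isSimplyConnected : IsSimplyConnected D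
  isBounded : Bornology.IsBounded D
  zero_mem : (0 : ℂ) ∈ D
  cycle_mem : f z₀ ∈ D
  subset_component : D ⊆ basinComponent f p z₀ 1
  jordan : ∃ γ : Circle → ℂ, Continuous γ ∧ Function.Injective γ ∧ range γ = frontier D
  frontier_subset : frontier D ⊆ basinComponent f p z₀ 1
  closure_image_subset : closure (f^[p] '' D) ⊆ D

/-- An admissible choice of the domain `C_p = E` inside `B_p = f⁻¹(D)`. It contains `z₀` and a left
half-plane; its boundary is a curve homeomorphic to the real line whose ends have imaginary parts
tending to `±∞`, which agrees with `∂B_p` where `|Im| < L₁` and is vertical where `|Im| > L₂`.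
The requirement that `L₁` is large says that `L₁ > |Im|` on the compact set `f^{p-1}(closure D)`. -/
structure IsTruncatedDomain (f : ℂ → ℂ) (p : ℕ) (z₀ : ℂ) (D E : Set ℂ) (L₁ L₂ : ℝ) : Prop where
  isOpen : IsOpen E
  isConnected : IsConnected E
  subset_preimage : E ⊆ f ⁻¹' D
  cycle_mem : z₀ ∈ E
  leftHalfPlane : ∃ c : ℝ, {w : ℂ | w.re < c} ⊆ E
  line : ∃ γ : ℝ → ℂ, Continuous γ ∧ Function.Injective γ ∧ range γ = frontier E ∧
    Tendsto (fun t => (γ t).im) atTop atTop ∧ Tendsto (fun t => (γ t).im) atBot atBot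
  L₁_large : ∀ w ∈ closure D, |(f^[p - 1] w).im| < L₁
  L₂_pos : 0 < L₂
  frontier_eq : frontier E ∩ {w | |w.im| < L₁} = frontier (f ⁻¹' D) ∩ {w | |w.im| < L₁}
  vertical_top : ∃ a : ℝ, frontier E ∩ {w | L₂ < w.im} = {w | w.re = a ∧ L₂ < w.im}
  vertical_bot : ∃ a : ℝ, frontier E ∩ {w | w.im < -L₂} = {w | w.re = a ∧ w.im < -L₂}

/-- The set `H_s = H_0 + 2πis`, where `H_0` is the component of `ℂ ∖ C_0` containing `w₀`. -/
noncomputable def strip (C₀ : Set ℂ) (w₀ : ℂ) (s : ℤ) : Set ℂ :=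
  (fun w : ℂ => w + 2 * (Real.pi : ℂ) * Complex.I * (s : ℂ)) '' connectedComponentIn C₀ᶜ w₀

/-- All the choices in the combinatorial construction for the attracting cycle of `z₀`: the domains
`D = B_{p+1}` and `C p ⊆ f⁻¹(D)`, the successive pull-backs `C j` (the component of `f⁻¹(C_{j+1})`
containing `z_j`, `0 ≤ j < p`), a base point `w₀` which selects `H_0` among the components
of `ℂ ∖ C_0`, and the integers `k_1, …, k_{p-1}` with `z_j ∈ H_{k_j}`. -/
structure Construction (f : ℂ → ℂ) (p : ℕ) (z₀ : ℂ) where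
  D : Set ℂ
  C : ℕ → Set ℂ
  L₁ : ℝ
  L₂ : ℝ
  w₀ : ℂ
  k : ℕ → ℤ
  isInitialDomain : IsInitialDomain f p z₀ D
  isTruncatedDomain : IsTruncatedDomain f p z₀ D (C p) L₁ L₂
  pullback : ∀ j, j < p → C j = connectedComponentIn (f ⁻¹' C (j + 1)) (f^[j] z₀)
  base_notMem : w₀ ∉ C 0
  kneading : ∀ j, 1 ≤ j → j < p → f^[j] z₀ ∈ strip (C 0) w₀ (k j)

/-- The sets `H_s`, `s ∈ ℤ`, of a construction. -/
noncomputable def Construction.H {f : ℂ → ℂ} {p : ℕ} {z₀ : ℂ} (𝒞 : Construction f p z₀) (s : ℤ) :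
    Set ℂ :=
  strip (𝒞.C 0) 𝒞.w₀ s

/-- The point `z` has itinerary `s` with respect to the sets `H`. -/
def HasItinerary (f : ℂ → ℂ) (H : ℤ → Set ℂ) (z : ℂ) (s : ℕ → ℤ) : Prop :=
  ∀ n, f^[n] z ∈ H (s n)

/-- `Σ_k`: the sequences `(t_0, k_1, …, k_{p-1}, t_1, k_1, …, k_{p-1}, t_2, …)`. -/
def kneadingSequences (p : ℕ) (k : ℕ → ℤ) : Set (ℕ → ℤ) :=
  {s | ∃ t : ℕ → ℤ, ∀ l : ℕ, s (l * p) = t l ∧ ∀ j, 1 ≤ j → j < p → s (l * p + j) = k j}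

end ExpBasin

/-! Upper bound. `C 0` contains a closed connected set that joins left infinity to right infinity
inside a horizontal strip. No translate of `H 0` can cross it, so imaginary parts are bounded on
each `H s` (`separation`, `exists_im_bound`). An itinerary in the given family therefore confines
the orbit to one fixed strip at all times not divisible by p, while escape forces the real part to
infinity. When a cover is pulled back through one period, a single step has infinitely many inverse
branches. The branch at height about 2πn is followed by a logarithm whose derivative there is
O(1/(|n|+1)), so the sum of s-th powers of diameters gains a factor comparable to ∑ (|n|+1)^(-s),
finite for s > 1, and also M^(-s) if all real parts are at least M. For M large each turn at least
halves both the mesh and the sum (`two_step_cover`, `improve_cover`), so the s-dimensional measure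
vanishes. Points that move to the right of M only later lie in countably many preimages, which do
not raise the dimension (`dimH_preimage_expMap_iterate_le`).

Lower bound. No measure is constructed. The set meets every vertical line far enough to the right
(`exists_point_on_line`), so its image under the 1-Lipschitz map Re contains a ray. The points come
from one inverse branch of f^p on a quarter-plane beside a vertical end of the boundary of `C p`.
Pulling back along the cycle through the domains `enlarged` keeps the intermediate images in the
prescribed H_{k_j}, and the quarter-plane misses `C p`, which puts the final values in a single `H
s` (`exists_return_branch`). Orbits that follow this branch forever are found by the intermediate
value theorem and compactness (`exists_orbit_of_branch`).

Membership in the Julia set is automatic for escaping points (`escapingSet_subset_juliaSet`). -/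

namespace ExpBasin

open scoped ENNReal NNReal

/-! ### Logarithms and components of preimages -/

section ExpMap

variable {lam : ℂ}

theorem expMap_ne_zero (hlam : lam ≠ 0) (z : ℂ) : expMap lam z ≠ 0 :=
  mul_ne_zero hlam (Complex.exp_ne_zero z)

theorem continuous_expMap : Continuous (expMap lam) := by
  unfold expMap; fun_prop

theorem continuous_expMap_iterate (n : ℕ) : Continuous ((expMap lam)^[n]) :=
  continuous_expMap.iterate n

theorem norm_expMap (z : ℂ) : ‖expMap lam z‖ = ‖lam‖ * Real.exp z.re := by
  simp [expMap, Complex.norm_exp]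

theorem expMap_add (z w : ℂ) : expMap lam (z + w) = expMap lam z * Complex.exp w := by
  simp [expMap, Complex.exp_add, mul_assoc]

theorem expMap_eq_iff (hlam : lam ≠ 0) {z w : ℂ} :
    expMap lam z = expMap lam w ↔ ∃ n : ℤ, z = w + 2 * (Real.pi : ℂ) * Complex.I * (n : ℂ) := by
  unfold expMap
  rw [mul_right_inj' hlam, Complex.exp_eq_exp_iff_exists_int]
  refine exists_congr fun n => ?_
  rw [mul_comm (n : ℂ)]

theorem expMap_add_period (z : ℂ) (n : ℤ) :
    expMap lam (z + 2 * (Real.pi : ℂ) * Complex.I * (n : ℂ)) = expMap lam z := by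
  rw [expMap_add, mul_comm _ (n : ℂ), Complex.exp_int_mul_two_pi_mul_I, mul_one]

/-- The logarithmic inverse branch of `expMap lam`. -/
theorem expMap_log (hlam : lam ≠ 0) {v : ℂ} (hv : v ≠ 0) (n : ℤ) :
    expMap lam (Complex.log v - Complex.log lam + 2 * (Real.pi : ℂ) * Complex.I * (n : ℂ)) = v := by
  rw [expMap_add_period, expMap, Complex.exp_sub, Complex.exp_log hv, Complex.exp_log hlam]
  field_simp

theorem exists_eq_log (hlam : lam ≠ 0) (z : ℂ) :
    ∃ n : ℤ, z = Complex.log (expMap lam z) - Complex.log lam +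
      2 * (Real.pi : ℂ) * Complex.I * (n : ℂ) := by
  rw [← expMap_eq_iff hlam]
  simpa using (expMap_log hlam (expMap_ne_zero hlam z) 0).symm

/-- A local section through a given point of the fibre. -/
theorem expMap_add_log_div (hlam : lam ≠ 0) (a : ℂ) {v : ℂ} (hv : v ≠ 0) :
    expMap lam (a + Complex.log (v / expMap lam a)) = v := by
  have := expMap_ne_zero hlam a
  rw [expMap_add, Complex.exp_log (div_ne_zero hv this)]
  field_simp

/-- Image of a connected set under a lift through a component of a preimage. -/
theorem lift_subset_component {f : ℂ → ℂ} {W S : Set ℂ} {z : ℂ} {g : ℂ → ℂ}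
    (hS : IsPreconnected S) (hg : ContinuousOn g S) (hfg : ∀ v ∈ S, f (g v) ∈ W) {s₀ : ℂ}
    (hs₀ : s₀ ∈ S) (h0 : g s₀ ∈ connectedComponentIn (f ⁻¹' W) z) :
    ∀ v ∈ S, g v ∈ connectedComponentIn (f ⁻¹' W) z := by
  intro v hv
  rw [connectedComponentIn_eq h0]
  refine (hS.image g hg).subset_connectedComponentIn (mem_image_of_mem g hs₀) ?_
    (mem_image_of_mem g hv)
  rintro _ ⟨u, hu, rfl⟩
  exact hfg u hu

/-- Local form of the covering property: near each point of `W`, the image of a component is all or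
nothing, apart from the omitted value 0. -/
theorem component_image_local (hlam : lam ≠ 0) {W : Set ℂ} (hW : IsOpen W) (z : ℂ) {v : ℂ}
    (hv : v ∈ W) : ∃ r > 0, ∀ a ∈ connectedComponentIn (expMap lam ⁻¹' W) z,
      expMap lam a ∈ Metric.ball v r → ∀ y ∈ Metric.ball v r, y ≠ 0 →
        ∃ b ∈ connectedComponentIn (expMap lam ⁻¹' W) z, expMap lam b = y := by
  obtain ⟨ε, hε, hεW⟩ := Metric.isOpen_iff.1 hW v hv
  by_cases hv0 : v = 0
  · subst hv0
    refine ⟨ε, hε, fun a ha hfa y hy hy0 => ?_⟩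
    have hl : 0 < ‖lam‖ := norm_pos_iff.2 hlam
    -- The whole preimage of the disc about 0 is a left half-plane. It is connected, so no branch of
    -- the logarithm is needed.
    have hcv : Convex ℝ {w : ℂ | w.re < Real.log (ε / ‖lam‖)} :=
      convex_halfSpace_re_lt _
    have key : ∀ w : ℂ, w.re < Real.log (ε / ‖lam‖) ↔ expMap lam w ∈ Metric.ball (0 : ℂ) ε := by
      intro w
      rw [mem_ball_zero_iff, norm_expMap, Real.lt_log_iff_exp_lt (by positivity), lt_div_iff₀ hl,
        mul_comm]
    have hb := expMap_log hlam hy0 0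
    refine ⟨_, ?_, hb⟩
    refine lift_subset_component (g := id) hcv.isPreconnected continuousOn_id
      (fun u hu => hεW ((key u).1 hu)) ((key a).2 hfa) ha _ ((key _).2 ?_)
    rw [hb]; exact hy
  · have hvn : 0 < ‖v‖ := norm_pos_iff.2 hv0
    -- With radius at most ‖v‖/3, the quotient of two points of the ball is within distance 1 of 1,
    -- so its principal logarithm is continuous.
    refine ⟨min ε (‖v‖ / 3), by positivity, fun a ha hfa y hy hy0 => ?_⟩
    have hsub : Metric.ball v (min ε (‖v‖ / 3)) ⊆ W :=
      (Metric.ball_subset_ball (min_le_left _ _)).trans hεW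
    refine ⟨a + Complex.log (y / expMap lam a), ?_, expMap_add_log_div hlam a hy0⟩
    have hfa0 := expMap_ne_zero hlam a
    have hball : ∀ u ∈ Metric.ball v (min ε (‖v‖ / 3)), ‖u - v‖ < ‖v‖ / 3 := fun u hu => by
      rw [← dist_eq_norm]; exact lt_of_lt_of_le hu (min_le_right _ _)
    have hne : ∀ u ∈ Metric.ball v (min ε (‖v‖ / 3)), u ≠ 0 := by
      rintro u hu rfl
      have := hball _ hu
      rw [zero_sub, norm_neg] at this
      linarith
    refine lift_subset_component (g := fun u => a + Complex.log (u / expMap lam a))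
      (convex_ball v (min ε (‖v‖ / 3))).isPreconnected ?_ ?_ hfa ?_ y hy
    · refine continuousOn_const.add (ContinuousOn.clog (by fun_prop) fun u hu => ?_)
      have h1 := hball u hu
      have h2 := hball _ hfa
      refine Complex.ball_one_subset_slitPlane ?_
      rw [mem_ball_iff_norm, div_sub_one hfa0, norm_div, div_lt_one (norm_pos_iff.2 hfa0)]
      have h3 : ‖u - expMap lam a‖ ≤ ‖u - v‖ + ‖expMap lam a - v‖ := by
        have := norm_sub_le (u - v) (expMap lam a - v)
        simpa using this
      have h4 : ‖v‖ ≤ ‖expMap lam a‖ + ‖expMap lam a - v‖ := by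
        have := norm_sub_le (expMap lam a) (expMap lam a - v)
        simpa using this
      linarith
    · intro u hu
      rw [expMap_add_log_div hlam a (hne u hu)]
      exact hsub hu
    · simpa [div_self hfa0] using ha

/-- A component of the preimage of a domain covers the domain, up to the omitted value `0`. -/
theorem exists_mem_component_of_mem (hlam : lam ≠ 0) {W : Set ℂ} (hW : IsOpen W)
    (hWc : IsPreconnected W) {z : ℂ} (hz : expMap lam z ∈ W) {v : ℂ} (hv : v ∈ W) (hv0 : v ≠ 0) :
    ∃ u ∈ connectedComponentIn (expMap lam ⁻¹' W) z, expMap lam u = v := by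
  set A := connectedComponentIn (expMap lam ⁻¹' W) z
  have hzA : z ∈ A := mem_connectedComponentIn hz
  -- `U` is open, and the local lemma makes it relatively closed in `W`; connectedness of `W` then
  -- gives W ⊆ U.
  let U : Set ℂ := {v | ∃ r > 0, ∀ y ∈ Metric.ball v r, y ≠ 0 → ∃ b ∈ A, expMap lam b = y}
  have hU : IsOpen U := by
    rw [Metric.isOpen_iff]
    rintro x ⟨r, hr, h⟩
    refine ⟨r, hr, fun y hy => ⟨r - dist y x, by simpa using hy, fun w hw => h w ?_⟩⟩
    have := dist_triangle w y x
    rw [Metric.mem_ball] at hw ⊢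
    linarith
  have hsub : W ⊆ U := by
    refine hWc.subset_of_closure_inter_subset hU ⟨expMap lam z, hz, ?_⟩ ?_
    · obtain ⟨r, hr, h⟩ := component_image_local hlam hW z hz
      exact ⟨r, hr, h z hzA (Metric.mem_ball_self hr)⟩
    · rintro x ⟨hx, hxW⟩
      obtain ⟨r, hr, h⟩ := component_image_local hlam hW z hxW
      obtain ⟨y, hyx, ρ, hρ, hy⟩ :=
        mem_closure_iff.1 hx _ Metric.isOpen_ball (Metric.mem_ball_self hr)
      have hne : (Metric.ball x r ∩ Metric.ball y ρ ∩ {0}ᶜ).Nonempty := by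
        have ho : IsOpen (Metric.ball x r ∩ Metric.ball y ρ) :=
          Metric.isOpen_ball.inter Metric.isOpen_ball
        exact (dense_compl_singleton (0 : ℂ)).inter_open_nonempty _ ho
          ⟨y, hyx, Metric.mem_ball_self hρ⟩
      obtain ⟨w, ⟨hw1, hw2⟩, hw0⟩ := hne
      obtain ⟨b, hb, rfl⟩ := hy w hw2 hw0
      exact ⟨r, hr, h b hb hw1⟩
  obtain ⟨r, hr, h⟩ := hsub hv
  exact h v (Metric.mem_ball_self hr) hv0

/-- The preimage of a domain containing `0` is connected. -/
theorem component_eq_preimage (hlam : lam ≠ 0) {W : Set ℂ} (hW : IsOpen W)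
    (hWc : IsPreconnected W) (h0 : (0 : ℂ) ∈ W) {z : ℂ} (hz : expMap lam z ∈ W) :
    connectedComponentIn (expMap lam ⁻¹' W) z = expMap lam ⁻¹' W := by
  refine (connectedComponentIn_subset _ _).antisymm fun w hw => ?_
  obtain ⟨ε, hε, hεW⟩ := Metric.isOpen_iff.1 hW 0 h0
  have hl : 0 < ‖lam‖ := norm_pos_iff.2 hlam
  have hcv : Convex ℝ {w : ℂ | w.re < Real.log (ε / ‖lam‖)} := convex_halfSpace_re_lt _
  have key : ∀ w : ℂ, w.re < Real.log (ε / ‖lam‖) ↔ expMap lam w ∈ Metric.ball (0 : ℂ) ε := by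
    intro w
    rw [mem_ball_zero_iff, norm_expMap, Real.lt_log_iff_exp_lt (by positivity), lt_div_iff₀ hl,
      mul_comm]
  have hv : ((ε / 2 : ℝ) : ℂ) ∈ Metric.ball (0 : ℂ) ε := by
    rw [mem_ball_zero_iff, Complex.norm_real, Real.norm_eq_abs, abs_of_pos (by positivity)]
    linarith
  have hv0 : ((ε / 2 : ℝ) : ℂ) ≠ 0 := by
    rw [Ne, Complex.ofReal_eq_zero]; positivity
  -- Every component of the preimage takes the value ε/2, so it meets the left half-plane over the
  -- disc; all components therefore coincide.
  obtain ⟨u, hu, hfu⟩ := exists_mem_component_of_mem hlam hW hWc hz (hεW hv) hv0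
  obtain ⟨u', hu', hfu'⟩ := exists_mem_component_of_mem hlam hW hWc (z := w) hw (hεW hv) hv0
  have := lift_subset_component (f := expMap lam) (W := W) (z := z) (g := id) hcv.isPreconnected
    continuousOn_id (fun y hy => hεW ((key y).1 hy)) ((key u).2 (hfu ▸ hv)) hu u'
    ((key u').2 (hfu' ▸ hv))
  rw [connectedComponentIn_eq this]
  have h2 := connectedComponentIn_eq hu'
  rw [id, ← h2]
  exact mem_connectedComponentIn hw

/-- Boundary points of a component of the preimage are mapped outside the (open) target. -/
theorem notMem_of_mem_closure_component {f : ℂ → ℂ} (hf : Continuous f) {W : Set ℂ}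
    (hW : IsOpen W) {z q : ℂ} (hq : q ∈ closure (connectedComponentIn (f ⁻¹' W) z))
    (hq' : q ∉ connectedComponentIn (f ⁻¹' W) z) : f q ∉ W := by
  intro hqW
  have ho : IsOpen (connectedComponentIn (f ⁻¹' W) q) := (hW.preimage hf).connectedComponentIn
  obtain ⟨y, hy1, hy2⟩ := mem_closure_iff.1 hq _ ho (mem_connectedComponentIn hqW)
  rw [connectedComponentIn_eq hy2, ← connectedComponentIn_eq hy1] at hq'
  exact hq' (mem_connectedComponentIn hqW)

end ExpMap

/-! ### Separating the plane by a set in a horizontal strip -/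

section Separation

theorem log_neg_of_im_pos {z : ℂ} (hz : 0 < z.im) :
    Complex.log (-z) = Complex.log z - Real.pi * Complex.I := by
  have hz0 : z ≠ 0 := by rintro rfl; simp at hz
  apply Complex.ext
  · simp [Complex.log_re]
  · simp [Complex.log_im, Complex.arg_neg_eq_arg_sub_pi_of_im_pos hz]

theorem log_neg_of_im_neg {z : ℂ} (hz : z.im < 0) :
    Complex.log (-z) = Complex.log z + Real.pi * Complex.I := by
  have hz0 : z ≠ 0 := by rintro rfl; simp at hz
  apply Complex.ext
  · simp [Complex.log_re]
  · simp [Complex.log_im, Complex.arg_neg_eq_arg_add_pi_of_im_neg hz]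

/-- The principal logarithm of a quotient of two points in the same open upper or lower
half-plane. -/
theorem log_div_of_same_half_plane {u v : ℂ} (h : (0 < u.im ∧ 0 < v.im) ∨ (u.im < 0 ∧ v.im < 0)) :
    Complex.log (v / u) = Complex.log v - Complex.log u := by
  have hu : u ≠ 0 := by rintro rfl; simp at h
  have hv : v ≠ 0 := by rintro rfl; simp at h
  have he : Complex.exp (Complex.log v - Complex.log u) = v / u := by
    rw [Complex.exp_sub, Complex.exp_log hu, Complex.exp_log hv]
  rw [← he, Complex.log_exp]
  · rw [Complex.sub_im, Complex.log_im, Complex.log_im]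
    rcases h with ⟨h1, h2⟩ | ⟨h1, h2⟩
    · have := Complex.arg_nonneg_iff.2 h2.le
      have := Complex.arg_lt_pi_iff.2 (Or.inr h1.ne')
      linarith
    · have := Complex.neg_pi_lt_arg v
      have := Complex.arg_neg_iff.2 h1
      linarith
  · rw [Complex.sub_im, Complex.log_im, Complex.log_im]
    rcases h with ⟨h1, h2⟩ | ⟨h1, h2⟩
    · have := Complex.arg_le_pi v
      have := Complex.arg_nonneg_iff.2 h1.le
      linarith
    · have := Complex.neg_pi_lt_arg u
      have := Complex.arg_neg_iff.2 h2
      linarith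

/-- A continuous function on a preconnected set all of whose values have the same exponential
is constant. -/
theorem constant_of_exp_eq {K : Set ℂ} (hK : IsPreconnected K) {q : ℂ → ℂ}
    (hq : ContinuousOn q K) {c : ℂ} (hc : ∀ w ∈ K, Complex.exp (q w) = c) {x y : ℂ} (hx : x ∈ K)
    (hy : y ∈ K) : q x = q y := by
  refine hK.induction₂ (fun a b => q a = q b) (fun a ha => ?_)
    (fun _ _ _ _ _ _ h h' => h.trans h') (fun _ _ _ _ h => h.symm) hx hy
  filter_upwards [self_mem_nhdsWithin,
    (hq a ha).eventually (Metric.ball_mem_nhds (q a) Real.two_pi_pos)] with b hb hab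
  obtain ⟨n, hn⟩ := Complex.exp_eq_exp_iff_exists_int.1 ((hc b hb).trans (hc a ha).symm)
  rw [dist_eq_norm, hn, add_sub_cancel_left, norm_mul] at hab
  have h2 : ‖(2 * (Real.pi : ℂ) * Complex.I)‖ = 2 * Real.pi := by
    simp [abs_of_pos Real.pi_pos]
  rw [h2, Complex.norm_intCast] at hab
  have h3 : |(n : ℝ)| < 1 := by
    by_contra! h
    nlinarith [Real.two_pi_pos]
  have h4 : n = 0 := Int.abs_lt_one_iff.1 (by exact_mod_cast h3)
  rw [hn, h4]
  simp

/-- A closed connected set which stays in a horizontal strip and is unbounded to the left and to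
the right separates the points above the strip from those below it. -/
theorem separation {Γ : Set ℂ} (hΓc : IsClosed Γ) (hΓ : IsPreconnected Γ) {B : ℝ}
    (hB : ∀ γ ∈ Γ, |γ.im| ≤ B) (hl : ∀ x : ℝ, ∃ γ ∈ Γ, γ.re < x) (hr : ∀ x : ℝ, ∃ γ ∈ Γ, x < γ.re)
    {H : Set ℂ} (hH : IsPreconnected H) (hdisj : Disjoint H Γ) {w₁ w₂ : ℂ} (h₁ : w₁ ∈ H)
    (h₂ : w₂ ∈ H) (hw₁ : B < w₁.im) (hw₂ : w₂.im < -B) : False := by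
  -- a compact connected set joining the two points
  obtain ⟨K, hKc, hKconn, hKd, hK₁, hK₂⟩ : ∃ K : Set ℂ, IsCompact K ∧ IsPreconnected K ∧
      Disjoint K Γ ∧ w₁ ∈ K ∧ w₂ ∈ K := by
    have hsub : H ⊆ Γᶜ := fun x hx => disjoint_left.1 hdisj hx
    have ho : IsOpen (connectedComponentIn Γᶜ w₁) := hΓc.isOpen_compl.connectedComponentIn
    have hcon : IsConnected (connectedComponentIn Γᶜ w₁) :=
      isConnected_connectedComponentIn_iff.2 (hsub h₁)
    have hp := ho.isConnected_iff_isPathConnected.1 hcon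
    have hHs := hH.subset_connectedComponentIn h₁ hsub
    obtain ⟨γ, hγ⟩ := hp.joinedIn w₁ (hHs h₁) w₂ (hHs h₂)
    refine ⟨range γ, isCompact_range γ.continuous, isPreconnected_range γ.continuous, ?_,
      ⟨0, γ.source⟩, ⟨1, γ.target⟩⟩
    rw [disjoint_left]
    rintro _ ⟨t, rfl⟩
    exact connectedComponentIn_subset _ _ (hγ t)
  obtain ⟨δ, hδ, hδK⟩ := hKc.exists_thickening_subset_open hΓc.isOpen_compl
    (fun x hx => disjoint_left.1 hKd hx)
  have hdist : ∀ w ∈ K, ∀ γ ∈ Γ, δ ≤ ‖γ - w‖ := by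
    intro w hw γ hγ
    by_contra! hlt
    refine hδK (Metric.mem_thickening_iff.2 ⟨w, hw, ?_⟩) hγ
    rwa [dist_eq_norm]
  obtain ⟨M, hM⟩ := hKc.isBounded.exists_norm_le
  obtain ⟨x, hxΓ, hx⟩ := hl (-M)
  obtain ⟨y, hyΓ, hy⟩ := hr M
  have hre : ∀ w ∈ K, |w.re| ≤ M := fun w hw => (Complex.abs_re_le_norm w).trans (hM w hw)
  -- A continuous logarithm on `K` of w ↦ (y-w)/(x-w), normalised by principal values above and
  -- below the strip. It exists for nearby x, y in Γ and can be composed along Γ.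
  let P : ℂ → ℂ → Prop := fun x y => ∃ q : ℂ → ℂ, ContinuousOn q K ∧ ∀ w ∈ K,
    Complex.exp (q w) = (y - w) / (x - w) ∧
      (B < |w.im| → q w = Complex.log (y - w) - Complex.log (x - w))
  have hne : ∀ w ∈ K, ∀ γ ∈ Γ, γ - w ≠ 0 := fun w hw γ hγ h0 => by
    have := hdist w hw γ hγ
    rw [h0, norm_zero] at this
    linarith
  have hside : ∀ w : ℂ, B < |w.im| → ∀ x ∈ Γ, ∀ y ∈ Γ,
      (0 < (x - w).im ∧ 0 < (y - w).im) ∨ ((x - w).im < 0 ∧ (y - w).im < 0) := by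
    intro w hw x hx y hy
    have h1 := abs_le.1 (hB x hx)
    have h2 := abs_le.1 (hB y hy)
    rcases lt_abs.1 hw with h | h
    · right; simp only [Complex.sub_im]; constructor <;> linarith
    · left; simp only [Complex.sub_im]; constructor <;> linarith
  have hlocal : ∀ x ∈ Γ, ∀ y ∈ Γ, ‖y - x‖ < δ → P x y := by
    intro x hx y hy hxy
    refine ⟨fun w => Complex.log ((y - w) / (x - w)), ?_, fun w hw => ⟨?_, fun hw' => ?_⟩⟩
    · refine ContinuousOn.clog (ContinuousOn.div (by fun_prop) (by fun_prop)
        fun w hw => hne w hw x hx) fun w hw => ?_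
      refine Complex.ball_one_subset_slitPlane ?_
      rw [mem_ball_iff_norm, div_sub_one (hne w hw x hx), norm_div,
        div_lt_one (norm_pos_iff.2 (hne w hw x hx)), sub_sub_sub_cancel_right]
      exact hxy.trans_le (hdist w hw x hx)
    · exact Complex.exp_log (div_ne_zero (hne w hw y hy) (hne w hw x hx))
    · exact log_div_of_same_half_plane (hside w hw' x hx y hy)
  have hP : P x y := by
    refine hΓ.induction₂' P (fun x hx => ?_) (fun a b c ha hb hc => ?_) hxΓ hyΓ
    · filter_upwards [self_mem_nhdsWithin, mem_nhdsWithin_of_mem_nhds (Metric.ball_mem_nhds x hδ)]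
        with y hy hxy
      rw [mem_ball_iff_norm] at hxy
      exact ⟨hlocal x hx y hy hxy, hlocal y hy x hx (by rwa [norm_sub_rev])⟩
    · rintro ⟨q, hq, hq'⟩ ⟨r, hr, hr'⟩
      refine ⟨fun w => q w + r w, hq.add hr, fun w hw => ⟨?_, fun h => ?_⟩⟩
      · have h1 := hne w hw b hb
        have h2 := hne w hw a ha
        rw [Complex.exp_add, (hq' w hw).1, (hr' w hw).1]
        field_simp
      · change q w + r w = _
        rw [(hq' w hw).2 h, (hr' w hw).2 h]
        ring
  obtain ⟨q, hq, hq'⟩ := hP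
  -- `K` lies to the right of x and to the left of y, so both principal logarithms are continuous on
  -- it.
  have hcont : ContinuousOn (fun w => q w - Complex.log (y - w) + Complex.log (w - x)) K := by
    refine (hq.sub (ContinuousOn.clog (by fun_prop) fun w hw => ?_)).add
      (ContinuousOn.clog (by fun_prop) fun w hw => ?_)
    · refine Complex.mem_slitPlane_iff.2 (Or.inl ?_)
      have := abs_le.1 (hre w hw)
      simp only [Complex.sub_re]; linarith
    · refine Complex.mem_slitPlane_iff.2 (Or.inl ?_)
      have := abs_le.1 (hre w hw)
      simp only [Complex.sub_re]; linarith
  have hexp : ∀ w ∈ K, Complex.exp (q w - Complex.log (y - w) + Complex.log (w - x)) = -1 := by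
    intro w hw
    have h1 := hne w hw x hxΓ
    have h2 := hne w hw y hyΓ
    have h3 : w - x ≠ 0 := by rwa [← neg_sub, neg_ne_zero]
    rw [Complex.exp_add, Complex.exp_sub, (hq' w hw).1, Complex.exp_log h2, Complex.exp_log h3]
    field_simp
    ring
  have heq := constant_of_exp_eq hKconn hcont hexp hK₁ hK₂
  have hx' := abs_le.1 (hB x hxΓ)
  rw [(hq' w₁ hK₁).2 (lt_abs.2 (Or.inl hw₁)), (hq' w₂ hK₂).2 (lt_abs.2 (Or.inr (by linarith))),
    ← neg_sub w₁ x, ← neg_sub w₂ x, log_neg_of_im_pos (z := w₁ - x) (by simp; linarith),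
    log_neg_of_im_neg (z := w₂ - x) (by simp; linarith)] at heq
  -- The constant function takes the value πi at `w₁` and -πi at `w₂`.
  have h4 : (2 * Real.pi : ℂ) * Complex.I = 0 := by linear_combination heq
  have h5 := congrArg Complex.im h4
  simp at h5

end Separation

/-! ### The basin splits into open phases -/

section Phases

/-- Points whose orbit under `f^p` converges to `f^j(z₀)`. -/
def basinPhase (f : ℂ → ℂ) (p : ℕ) (z₀ : ℂ) (j : ℕ) : Set ℂ :=
  {w | Tendsto (fun n => f^[p * n] w) atTop (𝓝 (f^[j] z₀))}

/-- Some ball about the fixed point of f^p is contracted towards it, and the phase is the union of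
the preimages of this ball. -/
theorem isOpen_basinPhase_zero {f : ℂ → ℂ} (hf : Continuous f) {p : ℕ} {z₀ : ℂ}
    (hd : DifferentiableAt ℂ f^[p] z₀) (hz₀ : f^[p] z₀ = z₀) (hlt : ‖deriv f^[p] z₀‖ < 1) :
    IsOpen (basinPhase f p z₀ 0) := by
  obtain ⟨c, hc1, hc2⟩ := exists_between hlt
  have hc0 : 0 ≤ c := (norm_nonneg _).trans hc1.le
  obtain ⟨r, hr, hball⟩ : ∃ r > 0, ∀ w ∈ Metric.ball z₀ r, ‖f^[p] w - z₀‖ ≤ c * ‖w - z₀‖ := by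
    have h1 := hd.hasDerivAt.isLittleO
    have h2 := h1.def (sub_pos.2 hc1)
    obtain ⟨r, hr, h⟩ := Metric.eventually_nhds_iff_ball.1 h2
    refine ⟨r, hr, fun w hw => ?_⟩
    have h3 := h w hw
    rw [hz₀] at h3
    have h4 : ‖(w - z₀) • deriv f^[p] z₀‖ = ‖w - z₀‖ * ‖deriv f^[p] z₀‖ := norm_smul _ _
    have h5 := norm_add_le (f^[p] w - z₀ - (w - z₀) • deriv f^[p] z₀)
      ((w - z₀) • deriv f^[p] z₀)
    rw [sub_add_cancel] at h5
    nlinarith [h3, h5, h4]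
  have hconv : ∀ w ∈ Metric.ball z₀ r, Tendsto (fun n => f^[p * n] w) atTop (𝓝 z₀) := by
    intro w hw
    rw [mem_ball_iff_norm] at hw
    have key : ∀ n, ‖f^[p * n] w - z₀‖ ≤ c ^ n * ‖w - z₀‖ := by
      intro n
      induction n with
      | zero => simp
      | succ n ih =>
        have h1 : c ^ n * ‖w - z₀‖ ≤ ‖w - z₀‖ :=
          mul_le_of_le_one_left (norm_nonneg _) (pow_le_one₀ hc0 hc2.le)
        have h2 := hball (f^[p * n] w) (by rw [mem_ball_iff_norm]; linarith)
        rw [← Function.iterate_add_apply, show p + p * n = p * (n + 1) by ring] at h2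
        calc _ ≤ _ := h2
          _ ≤ c * (c ^ n * ‖w - z₀‖) := by gcongr
          _ = _ := by ring
    rw [tendsto_iff_norm_sub_tendsto_zero]
    refine squeeze_zero (fun _ => norm_nonneg _) key ?_
    simpa using (tendsto_pow_atTop_nhds_zero_of_lt_one hc0 hc2).mul_const ‖w - z₀‖
  have heq : basinPhase f p z₀ 0 = ⋃ m : ℕ, f^[p * m] ⁻¹' Metric.ball z₀ r := by
    ext w
    simp only [basinPhase, mem_ofPred_eq, Function.iterate_zero, id, mem_iUnion, mem_preimage]
    constructor
    · intro h
      exact (h.eventually (Metric.ball_mem_nhds z₀ hr)).exists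
    · rintro ⟨m, hm⟩
      rw [← tendsto_add_atTop_iff_nat m]
      refine (hconv _ hm).congr fun n => ?_
      rw [← Function.iterate_add_apply, mul_add]
  rw [heq]
  exact isOpen_iUnion fun m => Metric.isOpen_ball.preimage (hf.iterate _)

theorem basinPhase_iterate {f : ℂ → ℂ} (hf : Continuous f) {p : ℕ} {z₀ w : ℂ} {j : ℕ}
    (h : w ∈ basinPhase f p z₀ j) (m : ℕ) : f^[m] w ∈ basinPhase f p z₀ (m + j) := by
  have := ((hf.iterate m).tendsto _).comp h
  rw [← Function.iterate_add_apply] at this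
  refine this.congr fun n => ?_
  simp only [Function.comp_apply]
  rw [← Function.iterate_add_apply, ← Function.iterate_add_apply, add_comm]

theorem basinPhase_of_iterate_mul {f : ℂ → ℂ} {p : ℕ} {z₀ w : ℂ} {j m : ℕ}
    (h : f^[p * m] w ∈ basinPhase f p z₀ j) : w ∈ basinPhase f p z₀ j := by
  unfold basinPhase at h ⊢
  rw [mem_ofPred_eq, ← tendsto_add_atTop_iff_nat m]
  refine h.congr fun n => ?_
  rw [← Function.iterate_add_apply, mul_add]

theorem basinPhase_congr {f : ℂ → ℂ} {p : ℕ} {z₀ : ℂ} {i j : ℕ} (h : f^[i] z₀ = f^[j] z₀) :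
    basinPhase f p z₀ i = basinPhase f p z₀ j := by
  unfold basinPhase
  rw [h]

theorem isOpen_basinPhase {f : ℂ → ℂ} (hf : Continuous f) {p : ℕ} (hp : 1 ≤ p) {z₀ : ℂ}
    (hd : DifferentiableAt ℂ f^[p] z₀) (hz₀ : f^[p] z₀ = z₀) (hlt : ‖deriv f^[p] z₀‖ < 1)
    (j : ℕ) : IsOpen (basinPhase f p z₀ j) := by
  have hper : f^[p * j] z₀ = z₀ := by
    rw [Function.iterate_mul]
    exact Function.iterate_fixed hz₀ j
  have hpj : (p - 1) * j + j = p * j := by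
    rw [← Nat.succ_mul, Nat.succ_eq_add_one, Nat.sub_add_cancel hp]
  -- Advancing phase j by (p-1)j steps gives phase pj, which is phase 0.
  have heq : basinPhase f p z₀ j = f^[(p - 1) * j] ⁻¹' basinPhase f p z₀ 0 := by
    ext w
    constructor
    · intro h
      have := basinPhase_iterate hf h ((p - 1) * j)
      rw [hpj] at this
      rwa [basinPhase_congr (i := p * j) (j := 0) (by simpa using hper)] at this
    · intro h
      have := basinPhase_iterate hf h j
      rw [← Function.iterate_add_apply, add_comm j ((p - 1) * j), hpj, add_zero] at this
      exact basinPhase_of_iterate_mul this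
  rw [heq]
  exact (isOpen_basinPhase_zero hf hd hz₀ hlt).preimage (hf.iterate _)

/-- Distinct phases are disjoint open sets that cover the basin, so a connected subset lies in one
of them. -/
theorem basinComponent_subset_basinPhase {f : ℂ → ℂ} (hf : Continuous f) {p : ℕ} (hp : 1 ≤ p)
    {z₀ : ℂ} (hd : DifferentiableAt ℂ f^[p] z₀) (hz₀ : f^[p] z₀ = z₀)
    (hlt : ‖deriv f^[p] z₀‖ < 1) (j : ℕ) : basinComponent f p z₀ j ⊆ basinPhase f p z₀ j := by
  have hmem : f^[j] z₀ ∈ basinPhase f p z₀ j := by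
    refine tendsto_const_nhds.congr fun n => ?_
    rw [← Function.iterate_add_apply, add_comm, Function.iterate_add_apply, Function.iterate_mul,
      Function.iterate_fixed hz₀]
  have hmem' : f^[j] z₀ ∈ basinComponent f p z₀ j := mem_connectedComponentIn ⟨j, hmem⟩
  have ho := isOpen_basinPhase hf hp hd hz₀ hlt
  refine IsPreconnected.subset_left_of_subset_union (ho j)
    (v := ⋃ i ∈ {i : ℕ | f^[i] z₀ ≠ f^[j] z₀}, basinPhase f p z₀ i)
    (isOpen_biUnion fun i _ => ho i) ?_ ?_ ⟨_, hmem', hmem⟩ isPreconnected_connectedComponentIn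
  · rw [disjoint_left]
    intro w h1 h2
    obtain ⟨i, hi, hw⟩ := mem_iUnion₂.1 h2
    exact hi (tendsto_nhds_unique hw h1)
  · intro w hw
    obtain ⟨i, hi⟩ := connectedComponentIn_subset _ _ hw
    by_cases h : f^[i] z₀ = f^[j] z₀
    · left; rw [← basinPhase_congr h]; exact hi
    · right; exact mem_iUnion₂.2 ⟨i, h, hi⟩

end Phases

/-! ### The pull-backs `C j` and the sets `H s` -/

section Geometry

variable {lam : ℂ} {p : ℕ} {z₀ : ℂ}

theorem differentiable_expMap : Differentiable ℂ (expMap lam) := by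
  unfold expMap; fun_prop

theorem differentiable_expMap_iterate (n : ℕ) : Differentiable ℂ ((expMap lam)^[n]) := by
  induction n with
  | zero => exact differentiable_id
  | succ n ih => rw [Function.iterate_succ]; exact ih.comp differentiable_expMap

theorem IsAttractingPeriodicPt.iterate_eq {f : ℂ → ℂ} (h : IsAttractingPeriodicPt f p z₀) :
    f^[p] z₀ = z₀ := by
  have := Function.isPeriodicPt_minimalPeriod f z₀
  rwa [h.1] at this

theorem initialDomain_subset_basinPhase (hp : 1 < p)
    (hz₀ : IsAttractingPeriodicPt (expMap lam) p z₀) {D : Set ℂ}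
    (hD : IsInitialDomain (expMap lam) p z₀ D) : D ⊆ basinPhase (expMap lam) p z₀ 1 :=
  hD.subset_component.trans (basinComponent_subset_basinPhase continuous_expMap hp.le
    (differentiable_expMap_iterate p z₀) hz₀.iterate_eq hz₀.2 1)

theorem IsPreconnected.subset_of_disjoint_frontier {S E : Set ℂ} (hS : IsPreconnected S)
    (hne : (S ∩ E).Nonempty) (hd : Disjoint S (frontier E)) : S ⊆ E := by
  by_contra h
  obtain ⟨x, hx, hxE⟩ := not_subset.1 h
  have h1 : S ⊆ interior E ∪ (closure E)ᶜ := fun y hy => by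
    by_cases h2 : y ∈ closure E
    · left
      by_contra h3
      exact disjoint_left.1 hd hy ⟨h2, h3⟩
    · right; exact h2
  obtain ⟨y, hy, hyE⟩ := hne
  have hS' := hS.subset_left_of_subset_union isOpen_interior isClosed_closure.isOpen_compl
    (disjoint_left.2 fun z hz hz' => hz' (subset_closure (interior_subset hz))) h1
    ⟨y, hy, (h1 hy).resolve_right fun h => h (subset_closure hyE)⟩
  exact hxE (interior_subset (hS' hx))

namespace Construction

variable (𝒞 : Construction (expMap lam) p z₀)

theorem isOpen_C {j : ℕ} (hj : j ≤ p) : IsOpen (𝒞.C j) := by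
  induction hj using Nat.decreasingInduction with
  | self => exact 𝒞.isTruncatedDomain.isOpen
  | of_succ j hj ih =>
    rw [𝒞.pullback j hj]
    exact (ih.preimage continuous_expMap).connectedComponentIn

theorem isPreconnected_C {j : ℕ} (hj : j ≤ p) : IsPreconnected (𝒞.C j) := by
  rcases hj.eq_or_lt with rfl | hj
  · exact 𝒞.isTruncatedDomain.isConnected.isPreconnected
  · rw [𝒞.pullback j hj]; exact isPreconnected_connectedComponentIn

theorem mem_C (hz₀ : IsAttractingPeriodicPt (expMap lam) p z₀) {j : ℕ} (hj : j ≤ p) :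
    (expMap lam)^[j] z₀ ∈ 𝒞.C j := by
  induction hj using Nat.decreasingInduction with
  | self => rw [hz₀.iterate_eq]; exact 𝒞.isTruncatedDomain.cycle_mem
  | of_succ j hj ih =>
    rw [𝒞.pullback j hj]
    refine mem_connectedComponentIn ?_
    rwa [mem_preimage, ← Function.iterate_succ_apply' (expMap lam)]

theorem map_C {j : ℕ} (hj : j < p) {w : ℂ} (hw : w ∈ 𝒞.C j) : expMap lam w ∈ 𝒞.C (j + 1) := by
  rw [𝒞.pullback j hj] at hw
  have h : w ∈ expMap lam ⁻¹' 𝒞.C (j + 1) := connectedComponentIn_subset _ _ hw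
  exact h

theorem iterate_C {j i : ℕ} (hj : j + i ≤ p) {w : ℂ} (hw : w ∈ 𝒞.C j) :
    (expMap lam)^[i] w ∈ 𝒞.C (j + i) := by
  induction i with
  | zero => exact hw
  | succ i ih =>
    rw [Function.iterate_succ_apply']
    exact 𝒞.map_C (j := j + i) (by omega) (ih (by omega))

/-- The image of `D` under f^(p-1) is connected and contains z_0. It lies where |Im| < L₁, so a
crossing of the frontier of `C p` would be a frontier point of the open set f⁻¹(D). That set
contains the image because f^p maps `D` into itself. Smaller j follow by pulling back. The case j =
1 puts 0 in `C 1`. -/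
theorem D_iterate_subset (hp : 1 < p) (hz₀ : IsAttractingPeriodicPt (expMap lam) p z₀) {j : ℕ}
    (hj : j ≤ p) (hj1 : 1 ≤ j) : (expMap lam)^[j - 1] '' 𝒞.D ⊆ 𝒞.C j := by
  have hD := 𝒞.isInitialDomain
  have hE := 𝒞.isTruncatedDomain
  have hDc : IsPreconnected 𝒞.D := hD.isSimplyConnected.isPathConnected.isConnected.isPreconnected
  have hcyc : ∀ j, 1 ≤ j → (expMap lam)^[j] z₀ ∈ (expMap lam)^[j - 1] '' 𝒞.D := by
    intro j hj1
    refine ⟨_, hD.cycle_mem, ?_⟩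
    rw [← Function.iterate_succ_apply (expMap lam)]
    congr 2
    omega
  have hconn : ∀ i, IsPreconnected ((expMap lam)^[i] '' 𝒞.D) := fun i =>
    hDc.image _ (continuous_expMap_iterate _).continuousOn
  induction hj using Nat.decreasingInduction with
  | self =>
    refine IsPreconnected.subset_of_disjoint_frontier (hconn _)
      ⟨_, hcyc p hp.le, 𝒞.mem_C hz₀ le_rfl⟩ ?_
    rw [disjoint_left]
    rintro _ ⟨w, hw, rfl⟩ hfr
    have h1 := hE.L₁_large w (subset_closure hw)
    have h2 := hE.frontier_eq.subset ⟨hfr, h1⟩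
    have h3 : (expMap lam)^[p - 1] w ∈ expMap lam ⁻¹' 𝒞.D := by
      rw [mem_preimage, ← Function.iterate_succ_apply' (expMap lam)]
      refine hD.closure_image_subset (subset_closure ⟨w, hw, ?_⟩)
      congr 2
      omega
    have h4 := (hD.isOpen.preimage (continuous_expMap (lam := lam))).interior_eq
    exact h2.1.2 (by rw [h4]; exact h3)
  | of_succ j hj ih =>
    have ih := ih (by omega)
    rw [𝒞.pullback j hj]
    refine (hconn _).subset_connectedComponentIn (hcyc j hj1) ?_
    rintro _ ⟨w, hw, rfl⟩
    rw [mem_preimage, ← Function.iterate_succ_apply' (expMap lam)]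
    refine ih ⟨w, hw, ?_⟩
    congr 2
    omega

theorem D_subset_C_one (hp : 1 < p) (hz₀ : IsAttractingPeriodicPt (expMap lam) p z₀) :
    𝒞.D ⊆ 𝒞.C 1 := by
  simpa using 𝒞.D_iterate_subset hp hz₀ hp.le le_rfl

theorem zero_mem_C_one (hp : 1 < p) (hz₀ : IsAttractingPeriodicPt (expMap lam) p z₀) :
    (0 : ℂ) ∈ 𝒞.C 1 := 𝒞.D_subset_C_one hp hz₀ 𝒞.isInitialDomain.zero_mem

/-- The orbit of a common point would be in phase 1 and in phase j-i+1 at the same time, giving z_0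
the period j-i < p. -/
theorem disjoint_C (hp : 1 < p) (hz₀ : IsAttractingPeriodicPt (expMap lam) p z₀) {i j : ℕ}
    (hij : i < j) (hj : j ≤ p) (hne : j - i < p) : Disjoint (𝒞.C i) (𝒞.C j) := by
  rw [disjoint_left]
  intro w hi hj'
  have key : ∀ j, j ≤ p → w ∈ 𝒞.C j →
      (expMap lam)^[p + 1 - j] w ∈ basinPhase (expMap lam) p z₀ 1 := by
    intro j hj hw
    have h1 := 𝒞.iterate_C (i := p - j) (by omega) hw
    rw [Nat.add_sub_cancel' hj] at h1
    have h2 := initialDomain_subset_basinPhase hp hz₀ 𝒞.isInitialDomain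
      (𝒞.isTruncatedDomain.subset_preimage h1)
    rwa [← Function.iterate_succ_apply' (expMap lam),
      show (p - j).succ = p + 1 - j by omega] at h2
  have h1 := key i (by omega) hi
  have h2 := basinPhase_iterate continuous_expMap (key j hj hj') (j - i)
  rw [← Function.iterate_add_apply, show j - i + (p + 1 - j) = p + 1 - i by omega] at h2
  have h3 : (expMap lam)^[1] z₀ = (expMap lam)^[j - i + 1] z₀ := tendsto_nhds_unique h1 h2
  have h4 := congrArg ((expMap lam)^[p - 1]) h3
  rw [← Function.iterate_add_apply, ← Function.iterate_add_apply, Nat.sub_add_cancel hp.le,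
    show p - 1 + (j - i + 1) = (j - i) + p by omega, Function.iterate_add_apply,
    hz₀.iterate_eq] at h4
  have h5 : Function.IsPeriodicPt (expMap lam) (j - i) z₀ := h4.symm
  have h6 := h5.minimalPeriod_le (by omega)
  rw [hz₀.1] at h6
  omega

theorem C_zero_eq (hlam : lam ≠ 0) (hp : 1 < p) (hz₀ : IsAttractingPeriodicPt (expMap lam) p z₀) :
    𝒞.C 0 = expMap lam ⁻¹' 𝒞.C 1 := by
  rw [𝒞.pullback 0 (by omega)]
  exact component_eq_preimage hlam (𝒞.isOpen_C hp.le) (𝒞.isPreconnected_C hp.le)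
    (𝒞.zero_mem_C_one hp hz₀) (𝒞.map_C (by omega) (𝒞.mem_C hz₀ (Nat.zero_le p)))

theorem add_period_mem_C_zero (hlam : lam ≠ 0) (hp : 1 < p)
    (hz₀ : IsAttractingPeriodicPt (expMap lam) p z₀) (z : ℂ) (n : ℤ) :
    z + 2 * (Real.pi : ℂ) * Complex.I * (n : ℂ) ∈ 𝒞.C 0 ↔ z ∈ 𝒞.C 0 := by
  rw [𝒞.C_zero_eq hlam hp hz₀, mem_preimage, mem_preimage, expMap_add_period]

theorem mem_H_iff {z : ℂ} {s : ℤ} : z ∈ 𝒞.H s ↔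
    z - 2 * (Real.pi : ℂ) * Complex.I * (s : ℂ) ∈ connectedComponentIn (𝒞.C 0)ᶜ 𝒞.w₀ := by
  unfold Construction.H strip
  constructor
  · rintro ⟨w, hw, rfl⟩
    simpa using hw
  · intro h
    exact ⟨_, h, by simp⟩

theorem add_period_mem_H_iff {z : ℂ} {s : ℤ} (n : ℤ) :
    z + 2 * (Real.pi : ℂ) * Complex.I * (n : ℂ) ∈ 𝒞.H (s + n) ↔ z ∈ 𝒞.H s := by
  rw [mem_H_iff, mem_H_iff]
  push_cast
  ring_nf

theorem isPreconnected_H (s : ℤ) : IsPreconnected (𝒞.H s) :=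
  isPreconnected_connectedComponentIn.image _ (by fun_prop)

theorem disjoint_H_C_zero (hlam : lam ≠ 0) (hp : 1 < p)
    (hz₀ : IsAttractingPeriodicPt (expMap lam) p z₀) (s : ℤ) : Disjoint (𝒞.H s) (𝒞.C 0) := by
  rw [disjoint_left]
  intro z hz hz'
  refine connectedComponentIn_subset _ _ (𝒞.mem_H_iff.1 hz) ?_
  have := (𝒞.add_period_mem_C_zero hlam hp hz₀ z (-s)).2 hz'
  simpa [sub_eq_add_neg] using this

/-- A connected subset of the complement of `C 0` which meets some `H s` is contained in it. -/
theorem subset_H (hlam : lam ≠ 0) (hp : 1 < p) (hz₀ : IsAttractingPeriodicPt (expMap lam) p z₀)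
    {X : Set ℂ} (hX : IsPreconnected X) (hd : Disjoint X (𝒞.C 0)) {x : ℂ} (hx : x ∈ X) {s : ℤ}
    (hxs : x ∈ 𝒞.H s) : X ⊆ 𝒞.H s := by
  intro y hy
  rw [mem_H_iff] at hxs ⊢
  rw [connectedComponentIn_eq hxs]
  refine (hX.image (fun z => z - 2 * (Real.pi : ℂ) * Complex.I * (s : ℂ))
    (by fun_prop)).subset_connectedComponentIn (mem_image_of_mem _ hx) ?_ (mem_image_of_mem _ hy)
  rintro _ ⟨z, hz, rfl⟩ hz'
  refine disjoint_left.1 hd hz ?_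
  have := (𝒞.add_period_mem_C_zero hlam hp hz₀ _ s).2 hz'
  simpa using this

end Construction

end Geometry

/-! ### Imaginary parts are bounded on each `H s` -/

section BoundedStrips

variable {lam : ℂ} {p : ℕ} {z₀ : ℂ}

theorem isClosed_range_comp_abs {g : ℝ → ℂ} (hg : Continuous g)
    (h : Tendsto (fun t => ‖g t‖) atTop atTop) : IsClosed (range fun t => g |t|) := by
  have hc : Continuous fun t : ℝ => g |t| := hg.comp continuous_abs
  refine (isProperMap_iff_tendsto_cocompact.2 ⟨hc, ?_⟩).isClosedMap.isClosed_range
  rw [← Metric.cobounded_eq_cocompact (α := ℂ), ← tendsto_norm_atTop_iff_cobounded]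
  exact h.comp tendsto_norm_cocompact_atTop

namespace Construction

variable (𝒞 : Construction (expMap lam) p z₀)

/-- Each pull-back domain contains a curve going to infinity to the right within a horizontal
strip. -/
theorem exists_curve (hlam : lam ≠ 0) (hz₀ : IsAttractingPeriodicPt (expMap lam) p z₀) {j : ℕ}
    (hj : j ≤ p - 1) (hp : 1 < p) : ∃ (γ : ℝ → ℂ) (B : ℝ), Continuous γ ∧ (∀ t, γ t ∈ 𝒞.C j) ∧
      (∀ t, |(γ t).im| ≤ B) ∧ Tendsto (fun t => (γ t).re) atTop atTop := by
  have hcover : ∀ j, j < p → ∀ v ∈ 𝒞.C (j + 1), v ≠ 0 → ∃ u ∈ 𝒞.C j, expMap lam u = v := by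
    intro j hj v hv hv0
    have := exists_mem_component_of_mem hlam (𝒞.isOpen_C (j := j + 1) hj)
      (𝒞.isPreconnected_C (j := j + 1) hj) (𝒞.map_C hj (𝒞.mem_C hz₀ hj.le)) hv hv0
    rwa [← 𝒞.pullback j hj] at this
  have hlift : ∀ j, j < p → ∀ g : ℝ → ℂ, Continuous g → g 0 ∈ 𝒞.C j →
      (∀ t, expMap lam (g t) ∈ 𝒞.C (j + 1)) → ∀ t, g t ∈ 𝒞.C j := by
    intro j hj g hg h0 hgt t
    rw [𝒞.pullback j hj] at h0 ⊢
    rw [connectedComponentIn_eq h0]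
    refine (isPreconnected_range hg).subset_connectedComponentIn (mem_range_self 0) ?_
      (mem_range_self t)
    rintro _ ⟨s, rfl⟩
    exact hgt s
  induction hj using Nat.decreasingInduction with
  | self =>
    obtain ⟨c, hc⟩ := 𝒞.isTruncatedDomain.leftHalfPlane
    have hp1 : p - 1 + 1 = p := Nat.sub_add_cancel hp.le
    set x : ℝ := min c 0 - 1 with hx
    have hx0 : x < 0 := by have := min_le_right c 0; linarith
    have hxc : x < c := by have := min_le_left c 0; linarith
    obtain ⟨a, ha, hfa⟩ := hcover (p - 1) (by omega) (x : ℂ)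
      (by rw [hp1]; exact hc (by simpa using hxc)) (by exact_mod_cast hx0.ne)
    -- A horizontal ray over a negative real point x: its image x·exp|t| stays in the left
    -- half-plane contained in `C p`.
    refine ⟨fun t => a + (|t| : ℝ), |a.im|, by fun_prop, ?_, fun t => by simp, ?_⟩
    · refine hlift (p - 1) (by omega) _ (by fun_prop) (by simpa using ha) fun t => ?_
      rw [hp1, expMap_add, hfa]
      refine hc ?_
      rw [mem_ofPred_eq, ← Complex.ofReal_exp, ← Complex.ofReal_mul, Complex.ofReal_re]
      have : 1 ≤ Real.exp |t| := Real.one_le_exp (abs_nonneg t)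
      nlinarith
    · simp only [Complex.add_re, Complex.ofReal_re]
      exact tendsto_atTop_add_const_left _ _ tendsto_abs_atTop_atTop
  | of_succ j hj ih =>
    -- The logarithm of a curve going to the right also goes to the right, and its argument is
    -- bounded. Only the part in the right half-plane is lifted, where the principal branch is
    -- continuous.
    obtain ⟨γ, B, hγ, hγC, hγB, hγr⟩ := ih
    obtain ⟨T, hT⟩ := eventually_atTop.1 (hγr.eventually_gt_atTop 0)
    have hpos : ∀ t, 0 < (γ (T + |t|)).re := fun t => hT _ (by linarith [abs_nonneg t])
    have hne : ∀ t, γ (T + |t|) ≠ 0 := fun t h => by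
      have := hpos t; rw [h] at this; simp at this
    obtain ⟨a, ha, hfa⟩ := hcover j (by omega) (γ (T + |(0 : ℝ)|)) (hγC _) (hne 0)
    have hcont : Continuous fun t : ℝ =>
        a + (Complex.log (γ (T + |t|)) - Complex.log (γ (T + |(0 : ℝ)|))) := by
      refine continuous_const.add ((Continuous.clog (by fun_prop) fun t => ?_).sub
        continuous_const)
      exact Complex.mem_slitPlane_iff.2 (Or.inl (hpos t))
    refine ⟨_, |a.im| + 2 * Real.pi, hcont, ?_, fun t => ?_, ?_⟩
    · refine hlift j (by omega) _ hcont (by simpa using ha) fun t => ?_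
      rw [expMap_add, Complex.exp_sub, Complex.exp_log (hne t), Complex.exp_log (hne 0), hfa,
        mul_div_cancel₀ _ (hne 0)]
      exact hγC _
    · simp only [Complex.add_im, Complex.sub_im, Complex.log_im]
      have h1 := Complex.abs_arg_le_pi (γ (T + |t|))
      have h2 := Complex.abs_arg_le_pi (γ (T + |(0 : ℝ)|))
      rw [abs_le] at h1 h2 ⊢
      have h3 := neg_abs_le a.im
      have h4 := le_abs_self a.im
      constructor <;> linarith
    · simp only [Complex.add_re, Complex.sub_re, Complex.log_re]
      refine tendsto_atTop_add_const_left _ _ (tendsto_atTop_add_const_right _ _ ?_)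
      refine Real.tendsto_log_atTop.comp ?_
      refine tendsto_atTop_mono (fun t => Complex.re_le_norm _) ?_
      exact hγr.comp (tendsto_atTop_add_const_left _ _ tendsto_abs_atTop_atTop)

theorem exists_separating_set (hlam : lam ≠ 0) (hp : 1 < p)
    (hz₀ : IsAttractingPeriodicPt (expMap lam) p z₀) : ∃ (Γ : Set ℂ) (B : ℝ), Γ ⊆ 𝒞.C 0 ∧
      IsClosed Γ ∧ IsPreconnected Γ ∧ (∀ γ ∈ Γ, |γ.im| ≤ B) ∧ (∀ x : ℝ, ∃ γ ∈ Γ, γ.re < x) ∧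
      ∀ x : ℝ, ∃ γ ∈ Γ, x < γ.re := by
  obtain ⟨γ, B, hγ, hγC, hγB, hγr⟩ := 𝒞.exists_curve hlam hz₀ (Nat.zero_le _) hp
  obtain ⟨ε, hε, hεC⟩ := Metric.isOpen_iff.1 (𝒞.isOpen_C hp.le) 0 (𝒞.zero_mem_C_one hp hz₀)
  have hl : 0 < ‖lam‖ := norm_pos_iff.2 hlam
  have hleft : ∀ w : ℂ, w.re < Real.log (ε / ‖lam‖) → w ∈ 𝒞.C 0 := by
    intro w hw
    rw [𝒞.C_zero_eq hlam hp hz₀]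
    refine hεC ?_
    rwa [mem_ball_zero_iff, norm_expMap, mul_comm, ← lt_div_iff₀ hl,
      ← Real.lt_log_iff_exp_lt (by positivity)]
  set a : ℝ := Real.log (ε / ‖lam‖) - 1 with ha
  have hray : ∀ t : ℝ, ((a - |t| : ℝ) : ℂ) ∈ 𝒞.C 0 := fun t => hleft _ (by
    rw [Complex.ofReal_re]; linarith [abs_nonneg t])
  have hpc : IsPathConnected (𝒞.C 0) :=
    (𝒞.isOpen_C (Nat.zero_le p)).isConnected_iff_isPathConnected.1
      ⟨⟨_, hγC 0⟩, 𝒞.isPreconnected_C (Nat.zero_le p)⟩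
  obtain ⟨q, hq⟩ := hpc.joinedIn _ (hray 0) _ (hγC |0|)
  obtain ⟨M, hM⟩ := (isCompact_range q.continuous).isBounded.exists_norm_le
  -- A ray to the left near the preimage of 0, a connecting path in `C 0`, and the curve to the
  -- right.
  refine ⟨range (fun t : ℝ => ((a - |t| : ℝ) : ℂ)) ∪ range q ∪ range (fun t => γ |t|), max B M,
    ?_, ?_, ?_, ?_, ?_, ?_⟩
  · rintro _ ((⟨t, rfl⟩ | ⟨t, rfl⟩) | ⟨t, rfl⟩)
    · exact hray t
    · exact hq t
    · exact hγC _
  · refine (IsClosed.union ?_ (isCompact_range q.continuous).isClosed).union ?_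
    · refine isClosed_range_comp_abs (g := fun t : ℝ => ((a - t : ℝ) : ℂ)) (by fun_prop) ?_
      simp only [Complex.norm_real, Real.norm_eq_abs]
      refine tendsto_abs_atBot_atTop.comp ?_
      exact tendsto_atBot_add_const_left _ a tendsto_neg_atTop_atBot
    · exact isClosed_range_comp_abs hγ (tendsto_atTop_mono (fun t => Complex.re_le_norm _) hγr)
  · refine IsPreconnected.union (γ |0|) (Or.inr ⟨1, q.target⟩) ⟨0, rfl⟩
      (IsPreconnected.union _ ⟨0, rfl⟩ ⟨0, q.source⟩
        (isPreconnected_range (by fun_prop)) (isPreconnected_range q.continuous))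
      (isPreconnected_range (by fun_prop))
  · rintro _ ((⟨t, rfl⟩ | ⟨t, rfl⟩) | ⟨t, rfl⟩)
    · have := hM _ ⟨0, rfl⟩
      simp only [Complex.ofReal_im, abs_zero]
      exact le_max_of_le_right ((norm_nonneg _).trans this)
    · exact le_max_of_le_right ((Complex.abs_im_le_norm _).trans (hM _ ⟨t, rfl⟩))
    · exact le_max_of_le_left (hγB _)
  · intro x
    refine ⟨_, Or.inl (Or.inl ⟨|a - x| + 1, rfl⟩), ?_⟩
    rw [Complex.ofReal_re, abs_of_nonneg (by positivity)]
    linarith [le_abs_self (a - x)]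
  · intro x
    obtain ⟨t, ht, ht0⟩ := ((hγr.eventually_gt_atTop x).and (eventually_ge_atTop 0)).exists
    exact ⟨γ |t|, Or.inr ⟨t, rfl⟩, by rwa [abs_of_nonneg ht0]⟩

/-- The imaginary part is bounded on each `H s`. -/
theorem exists_im_bound (hlam : lam ≠ 0) (hp : 1 < p)
    (hz₀ : IsAttractingPeriodicPt (expMap lam) p z₀) (s : ℤ) :
    ∃ B : ℝ, ∀ z ∈ 𝒞.H s, |z.im| ≤ B := by
  obtain ⟨Γ, B, hΓC, hΓc, hΓ, hB, hl, hr⟩ := 𝒞.exists_separating_set hlam hp hz₀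
  have hsep : ∀ s : ℤ, ∀ z ∈ 𝒞.H s, ∀ w ∈ 𝒞.H s, B < z.im → -B ≤ w.im := by
    intro s z hz w hw hzB
    by_contra! hwB
    exact separation hΓc hΓ hB hl hr (𝒞.isPreconnected_H s)
      ((𝒞.disjoint_H_C_zero hlam hp hz₀ s).mono_right hΓC) hz hw hzB hwB
  have him : ∀ (z : ℂ) (n : ℤ),
      (z + 2 * (Real.pi : ℂ) * Complex.I * (n : ℂ)).im = z.im + 2 * Real.pi * n := by
    intro z n; simp
  obtain ⟨w, hw⟩ : (𝒞.H s).Nonempty :=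
    ⟨_, mem_image_of_mem _ (mem_connectedComponentIn 𝒞.base_notMem)⟩
  have hpi := Real.pi_gt_three
  obtain ⟨m, hm⟩ := exists_nat_gt (|w.im| + |B|)
  have hm' : |w.im| + |B| < 2 * Real.pi * m := by
    have : (0 : ℝ) ≤ m := m.cast_nonneg
    nlinarith
  have hw1 := abs_le.1 (le_refl |w.im|)
  have hB1 := abs_le.1 (le_refl |B|)
  -- Shifting up by 2πm lifts w above the strip, so no point of the shifted set can be below it.
  -- Shifting down by 2πm puts w below the strip, which bounds z from above.
  refine ⟨2 * Real.pi * m + |B|, fun z hz => abs_le.2 ⟨?_, ?_⟩⟩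
  · have h := hsep _ _ ((𝒞.add_period_mem_H_iff m).2 hw) _ ((𝒞.add_period_mem_H_iff m).2 hz)
    rw [him, him] at h
    push_cast at h
    have := h (by linarith)
    linarith
  · by_contra! hlt
    have h := hsep _ _ ((𝒞.add_period_mem_H_iff (-m)).2 hz) _ ((𝒞.add_period_mem_H_iff (-m)).2 hw)
    rw [him, him] at h
    push_cast at h
    have := h (by linarith)
    linarith

theorem exists_im_bound_kneading (hlam : lam ≠ 0) (hp : 1 < p)
    (hz₀ : IsAttractingPeriodicPt (expMap lam) p z₀) :
    ∃ B : ℝ, ∀ j, 1 ≤ j → j < p → ∀ z ∈ 𝒞.H (𝒞.k j), |z.im| ≤ B := by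
  choose B hB using 𝒞.exists_im_bound hlam hp hz₀
  obtain ⟨M, hM⟩ := ((Finset.range p).image fun j => B (𝒞.k j)).exists_le
  exact ⟨M, fun j _ hj z hz => (hB _ z hz).trans
    (hM _ (Finset.mem_image_of_mem _ (Finset.mem_range.2 hj)))⟩

theorem C_subset_H (hlam : lam ≠ 0) (hp : 1 < p)
    (hz₀ : IsAttractingPeriodicPt (expMap lam) p z₀) {j : ℕ} (hj1 : 1 ≤ j) (hj : j < p) :
    𝒞.C j ⊆ 𝒞.H (𝒞.k j) :=
  𝒞.subset_H hlam hp hz₀ (𝒞.isPreconnected_C hj.le)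
    (𝒞.disjoint_C hp hz₀ hj1 hj.le (by omega)).symm (𝒞.mem_C hz₀ hj.le) (𝒞.kneading j hj1 hj)

end Construction

end BoundedStrips

/-! ### Escaping points are in the Julia set -/

section Julia

variable {lam : ℂ}

theorem hasDerivAt_expMap (z : ℂ) : HasDerivAt (expMap lam) (expMap lam z) z := by
  unfold expMap
  exact (Complex.hasDerivAt_exp z).const_mul lam

theorem deriv_expMap_iterate_succ (n : ℕ) (z : ℂ) :
    deriv ((expMap lam)^[n + 1]) z = (expMap lam)^[n + 1] z * deriv ((expMap lam)^[n]) z := by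
  rw [Function.iterate_succ']
  exact ((hasDerivAt_expMap _).comp z (differentiable_expMap_iterate n z).hasDerivAt).deriv

theorem tendsto_norm_deriv_of_mem_escapingSet (hlam : lam ≠ 0) {z : ℂ}
    (hz : z ∈ escapingSet (expMap lam)) :
    Tendsto (fun n => ‖deriv ((expMap lam)^[n]) z‖) atTop atTop := by
  have hpos : ∀ n, 0 < ‖deriv ((expMap lam)^[n]) z‖ := by
    intro n
    rw [norm_pos_iff]
    induction n with
    | zero => simp
    | succ n ih =>
      rw [deriv_expMap_iterate_succ, Function.iterate_succ_apply']
      exact mul_ne_zero (expMap_ne_zero hlam _) ih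
  have h1 : Tendsto (fun n => ‖(expMap lam)^[n] z‖) atTop atTop :=
    tendsto_norm_cobounded_atTop.comp hz
  obtain ⟨N, hN⟩ := eventually_atTop.1 (h1.eventually_ge_atTop 2)
  have key : ∀ n, ‖deriv ((expMap lam)^[N]) z‖ * 2 ^ n ≤ ‖deriv ((expMap lam)^[n + N]) z‖ := by
    intro n
    induction n with
    | zero => simp
    | succ n ih =>
      rw [show n + 1 + N = n + N + 1 by ring, deriv_expMap_iterate_succ, norm_mul]
      have := hN (n + N + 1) (by omega)
      calc _ = 2 * (‖deriv ((expMap lam)^[N]) z‖ * 2 ^ n) := by ring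
        _ ≤ _ := by gcongr
  rw [← tendsto_add_atTop_iff_nat N]
  refine tendsto_atTop_mono key ?_
  exact (tendsto_pow_atTop_atTop_of_one_lt one_lt_two).const_mul_atTop (hpos N)

/-- Cauchy's estimate for h^i = exp(i log h), whose modulus lies between e^(-π/2) and e^(π/2) when
Re h > 0. -/
theorem norm_deriv_log_le {h : ℂ → ℂ} (hd : Differentiable ℂ h) {z : ℂ} {r : ℝ} (hr : 0 < r)
    (hpos : ∀ w ∈ Metric.closedBall z r, 0 < (h w).re) :
    ‖deriv h z / h z‖ ≤ Real.exp Real.pi / r := by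
  let F : ℂ → ℂ := fun w => Complex.exp (Complex.I * Complex.log (h w))
  have hsl : ∀ w ∈ Metric.closedBall z r, h w ∈ Complex.slitPlane := fun w hw =>
    Complex.mem_slitPlane_iff.2 (Or.inl (hpos w hw))
  have hF : ∀ w ∈ Metric.closedBall z r,
      HasDerivAt F (F w * (Complex.I * (deriv h w / h w))) w := fun w hw =>
    (((hd w).hasDerivAt.clog (hsl w hw)).const_mul Complex.I).cexp
  have hn : ∀ w, ‖F w‖ = Real.exp (-(h w).arg) := by
    intro w
    simp [F, Complex.norm_exp, Complex.log_im]
  have hcl : DiffContOnCl ℂ F (Metric.ball z r) := by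
    refine DifferentiableOn.diffContOnCl fun w hw => ?_
    exact (hF w (Metric.closure_ball_subset_closedBall hw)).differentiableAt.differentiableWithinAt
  have h1 := Complex.norm_deriv_le_of_forall_mem_sphere_norm_le hr hcl
    (C := Real.exp (Real.pi / 2)) fun w hw => by
      rw [hn]
      gcongr
      have := (abs_le.1 (Complex.abs_arg_le_pi_div_two_iff.2
        (hpos w (Metric.sphere_subset_closedBall hw)).le)).1
      linarith
  have hz := Metric.mem_closedBall_self (x := z) hr.le
  rw [(hF z hz).deriv, norm_mul, norm_mul, Complex.norm_I, one_mul, hn] at h1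
  have h2 : Real.exp (-(Real.pi / 2)) ≤ Real.exp (-(h z).arg) := by
    gcongr
    exact (abs_le.1 (Complex.abs_arg_le_pi_div_two_iff.2 (hpos z hz).le)).2
  have h3 : Real.exp (-(Real.pi / 2)) * ‖deriv h z / h z‖ ≤ Real.exp (Real.pi / 2) / r :=
    (mul_le_mul_of_nonneg_right h2 (norm_nonneg _)).trans h1
  have h4 : Real.exp (Real.pi / 2) * Real.exp (-(Real.pi / 2)) = 1 := by
    rw [← Real.exp_add]; simp
  have h5 : Real.exp (Real.pi / 2) * Real.exp (Real.pi / 2) = Real.exp Real.pi := by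
    rw [← Real.exp_add]; congr 1; ring
  calc ‖deriv h z / h z‖
      = Real.exp (Real.pi / 2) * (Real.exp (-(Real.pi / 2)) * ‖deriv h z / h z‖) := by
        rw [← mul_assoc, h4, one_mul]
    _ ≤ Real.exp (Real.pi / 2) * (Real.exp (Real.pi / 2) / r) := by gcongr
    _ = _ := by rw [← mul_div_assoc, h5]

/-- Escaping points of an exponential map belong to its Julia set. -/
theorem escapingSet_subset_juliaSet (hlam : lam ≠ 0) :
    escapingSet (expMap lam) ⊆ juliaSet (expMap lam) := by
  rintro z hz ⟨V, hVo, hzV, hV⟩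
  -- The shift by two makes |f^(n+2)| control the sign of Re f^(n+1), whose logarithmic derivative
  -- is the derivative of f^n.
  obtain ⟨φ, hφ, h⟩ := hV fun n => n + 2
  have hφt := hφ.tendsto_atTop
  have hesc : Tendsto (fun n => (expMap lam)^[φ n + 2] z) atTop (Bornology.cobounded ℂ) :=
    Tendsto.comp (f := fun n => φ n + 2) hz
      (tendsto_atTop_mono (fun n => Nat.le_add_right _ 2) hφt)
  rcases h with ⟨g, hg⟩ | h
  · have h1 := hg.tendsto_at hzV
    have h2 := h1.not_tendsto (Metric.disjoint_nhds_cobounded (g z))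
    exact h2 hesc
  · obtain ⟨r, hr, hrV⟩ := Metric.nhds_basis_closedBall.mem_iff.1 (hVo.mem_nhds hzV)
    have h1 := h _ hrV (isCompact_closedBall z r) (‖lam‖ + 1)
    have h2 := (tendsto_norm_deriv_of_mem_escapingSet hlam hz).comp hφt
    obtain ⟨n, hn1, hn2⟩ := (h1.and (h2.eventually_gt_atTop (Real.exp Real.pi / r))).exists
    have hl : 0 < ‖lam‖ := norm_pos_iff.2 hlam
    have h3 := norm_deriv_log_le (differentiable_expMap_iterate (lam := lam) (φ n + 1)) hr
      (z := z) fun w hw => by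
        have h4 := hn1 w hw
        rw [Function.iterate_succ_apply', norm_expMap] at h4
        by_contra! h5
        have h6 : Real.exp ((expMap lam)^[φ n + 1] w).re ≤ 1 := Real.exp_le_one_iff.2 h5
        nlinarith
    have hne : (expMap lam)^[φ n + 1] z ≠ 0 := by
      rw [Function.iterate_succ_apply']; exact expMap_ne_zero hlam _
    -- The logarithmic derivative is now the derivative of an iterate at z, bounded by e^π/r
    -- although it tends to infinity.
    rw [deriv_expMap_iterate_succ, mul_div_cancel_left₀ _ hne] at h3
    exact absurd hn2 (not_lt.2 h3)

end Julia

/-! ### Dimension of preimages -/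

section Preimage

variable {lam : ℂ}

/-- Taking preimages under an exponential map does not increase the Hausdorff dimension. -/
theorem dimH_preimage_expMap_le (hlam : lam ≠ 0) (X : Set ℂ) :
    dimH (expMap lam ⁻¹' X) ≤ dimH X := by
  have hkey : ∀ (c : ℂ) (n : ℤ), c ≠ 0 → dimH ((fun v : ℂ => Complex.log (c * v) -
      Complex.log (c * lam) + 2 * (Real.pi : ℂ) * Complex.I * (n : ℂ)) ''
      (X ∩ {v | c * v ∈ Complex.slitPlane})) ≤ dimH X := by
    intro c n hc
    refine (dimH_image_le_of_locally_lipschitzOn fun v hv => ?_).trans (dimH_mono inter_subset_left)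
    have hcd : ContDiffAt ℂ 1 (fun v : ℂ => Complex.log (c * v) -
      Complex.log (c * lam) + 2 * (Real.pi : ℂ) * Complex.I * (n : ℂ)) v := by
      refine (((Complex.contDiffAt_log hv.2).comp v
        (contDiffAt_const.mul contDiffAt_id)).sub contDiffAt_const).add contDiffAt_const
    obtain ⟨K, t, ht, hK⟩ := hcd.exists_lipschitzOnWith
    exact ⟨K, t, mem_nhdsWithin_of_mem_nhds ht, hK⟩
  -- The slit plane and its negative cover all nonzero values, so countably many locally Lipschitz
  -- branches suffice.
  have hsub : expMap lam ⁻¹' X ⊆ ⋃ q : Bool × ℤ, (fun v : ℂ =>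
      Complex.log ((if q.1 then 1 else -1) * v) - Complex.log ((if q.1 then 1 else -1) * lam) +
        2 * (Real.pi : ℂ) * Complex.I * (q.2 : ℂ)) ''
      (X ∩ {v | (if q.1 then 1 else -1) * v ∈ Complex.slitPlane}) := by
    intro z hz
    have hmem : ∀ b : Bool, (if b then 1 else -1) * expMap lam z ∈ Complex.slitPlane →
        ∃ n : ℤ, z ∈ (fun v : ℂ => Complex.log ((if b then 1 else -1) * v) -
          Complex.log ((if b then 1 else -1) * lam) + 2 * (Real.pi : ℂ) * Complex.I * (n : ℂ)) ''
            (X ∩ {v | (if b then 1 else -1) * v ∈ Complex.slitPlane}) := by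
      intro b hb
      have hb0 : (if b then 1 else -1 : ℂ) ≠ 0 := by cases b <;> simp
      obtain ⟨n, hn⟩ := exists_eq_log (lam := (if b then 1 else -1) * lam)
        (mul_ne_zero hb0 hlam) z
      refine ⟨n, _, ⟨hz, hb⟩, ?_⟩
      have he : expMap ((if b then 1 else -1) * lam) z =
          (if b then 1 else -1) * expMap lam z := by simp [expMap]
      rw [he] at hn
      exact hn.symm
    have hne := expMap_ne_zero hlam z
    by_cases h : expMap lam z ∈ Complex.slitPlane
    · obtain ⟨n, hn⟩ := hmem true (by simpa using h)
      exact mem_iUnion.2 ⟨(true, n), hn⟩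
    · obtain ⟨n, hn⟩ := hmem false (by
        have := Complex.mem_slitPlane_or_neg_mem_slitPlane hne
        simpa using this.resolve_left h)
      exact mem_iUnion.2 ⟨(false, n), hn⟩
  refine (dimH_mono hsub).trans ?_
  rw [dimH_iUnion]
  exact iSup_le fun q => hkey _ _ (by split_ifs <;> simp)

theorem dimH_preimage_expMap_iterate_le (hlam : lam ≠ 0) (X : Set ℂ) (n : ℕ) :
    dimH ((expMap lam)^[n] ⁻¹' X) ≤ dimH X := by
  induction n with
  | zero => simp
  | succ n ih =>
    rw [Function.iterate_succ, preimage_comp]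
    exact (dimH_preimage_expMap_le hlam _).trans ih

end Preimage

/-! ### Contraction rates of the inverse branches -/

section UpperBound

variable {lam : ℂ}

/-- The orbit stays to the right of `M`, and its imaginary part is bounded by `B` except possibly
at the times `n ≡ -r` modulo `p`. -/
def returnSet (lam : ℂ) (p : ℕ) (B M : ℝ) (r : ℕ) : Set ℂ :=
  {w | ∀ n, M ≤ ((expMap lam)^[n] w).re ∧ ((n + r) % p ≠ 0 → |((expMap lam)^[n] w).im| ≤ B)}

theorem map_returnSet {p : ℕ} {B M : ℝ} {r : ℕ} {w : ℂ} (hw : w ∈ returnSet lam p B M r) :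
    expMap lam w ∈ returnSet lam p B M (r + 1) := by
  intro n
  have := hw (n + 1)
  rw [Function.iterate_succ_apply, show n + 1 + r = n + (r + 1) by ring] at this
  exact this

theorem returnSet_add_period {p : ℕ} {B M : ℝ} {r : ℕ} :
    returnSet lam p B M (r + p) = returnSet lam p B M r := by
  unfold returnSet
  simp only [← add_assoc, Nat.add_mod_right]

/-- `X` has a countable cover by sets of diameter at most `δ` with `∑ diam ^ s ≤ S`. -/
def HasCover (s : ℝ) (X : Set ℂ) (δ S : ℝ≥0∞) : Prop :=
  ∃ (ι : Type) (_ : Countable ι) (E : ι → Set ℂ), X ⊆ ⋃ i, E i ∧ (∀ i, Metric.ediam (E i) ≤ δ) ∧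
    ∑' i, Metric.ediam (E i) ^ s ≤ S

/-- Covers can be refined set by set. -/
theorem HasCover.refine {s : ℝ} {X Y : Set ℂ} {g : ℂ → ℂ} {δ S δ' c : ℝ≥0∞}
    (h : HasCover s Y δ S) (hg : MapsTo g X Y) {β : Type} [Countable β]
    (href : ∀ E : Set ℂ, E ⊆ Y → ∃ T : β → Set ℂ, X ∩ g ⁻¹' E ⊆ ⋃ b, T b ∧
      (∀ b, Metric.ediam (T b) ≤ δ' * Metric.ediam E) ∧
      ∑' b, Metric.ediam (T b) ^ s ≤ c * Metric.ediam E ^ s) (hs : 0 ≤ s) :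
    HasCover s X (δ' * δ) (c * S) := by
  obtain ⟨ι, _, E, hE, hδ, hS⟩ := h
  choose T hT hTδ hTs using fun i => href (E i ∩ Y) inter_subset_right
  refine ⟨ι × β, inferInstance, fun q => T q.1 q.2, ?_, ?_, ?_⟩
  · intro x hx
    obtain ⟨i, hi⟩ := mem_iUnion.1 (hE (hg hx))
    obtain ⟨b, hb⟩ := mem_iUnion.1 (hT i ⟨hx, hi, hg hx⟩)
    exact mem_iUnion.2 ⟨(i, b), hb⟩
  · rintro ⟨i, b⟩
    refine (hTδ i b).trans ?_
    gcongr
    exact (Metric.ediam_mono inter_subset_left).trans (hδ i)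
  · calc ∑' q : ι × β, Metric.ediam (T q.1 q.2) ^ s
        = ∑' i, ∑' b, Metric.ediam (T i b) ^ s :=
          ENNReal.tsum_prod (f := fun i b => Metric.ediam (T i b) ^ s)
      _ ≤ ∑' i, c * Metric.ediam (E i) ^ s := by
          refine ENNReal.tsum_le_tsum fun i => (hTs i).trans ?_
          gcongr
          exact inter_subset_left
      _ = c * ∑' i, Metric.ediam (E i) ^ s := ENNReal.tsum_mul_left
      _ ≤ c * S := by gcongr

theorem norm_log_sub_log_le {Y : Set ℂ} (hY : Convex ℝ Y) {c : ℝ} (hc : 0 < c)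
    (hpos : ∀ v ∈ Y, 0 < v.re) (hle : ∀ v ∈ Y, c ≤ ‖v‖) {a b : ℂ} (ha : a ∈ Y) (hb : b ∈ Y) :
    ‖Complex.log a - Complex.log b‖ ≤ c⁻¹ * ‖a - b‖ := by
  refine hY.norm_image_sub_le_of_norm_hasDerivWithin_le (f' := fun v => v⁻¹)
    (fun v hv => (Complex.hasDerivAt_log (Complex.mem_slitPlane_iff.2
      (Or.inl (hpos v hv)))).hasDerivWithinAt) (fun v hv => ?_) hb ha
  rw [norm_inv]
  exact inv_anti₀ hc (hle v hv)

/-- The index of the inverse branch that sends `f(z)` back to `z`. -/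
noncomputable def branchIndex (lam z : ℂ) : ℤ :=
  if h : lam ≠ 0 then (exists_eq_log h z).choose else 0

theorem eq_log_branchIndex (hlam : lam ≠ 0) (z : ℂ) :
    z = Complex.log (expMap lam z) - Complex.log lam +
      2 * (Real.pi : ℂ) * Complex.I * (branchIndex lam z : ℂ) := by
  rw [branchIndex, dif_pos hlam]
  exact (exists_eq_log hlam z).choose_spec

theorem sub_eq_log_sub_log (hlam : lam ≠ 0) {z w : ℂ}
    (h : branchIndex lam z = branchIndex lam w) :
    z - w = Complex.log (expMap lam z) - Complex.log (expMap lam w) := by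
  have h1 := eq_log_branchIndex hlam z
  have h2 := eq_log_branchIndex hlam w
  rw [h] at h1
  linear_combination h1 - h2

theorem abs_im_sub_branchIndex_le (hlam : lam ≠ 0) (z : ℂ) :
    |z.im - 2 * Real.pi * branchIndex lam z| ≤ 2 * Real.pi := by
  have h := congrArg Complex.im (eq_log_branchIndex hlam z)
  simp only [Complex.add_im, Complex.sub_im, Complex.log_im, Complex.mul_im, Complex.mul_re,
    Complex.intCast_im, Complex.intCast_re, Complex.I_im, Complex.I_re, Complex.ofReal_re,
    Complex.ofReal_im] at h
  norm_num at h
  have h1 := abs_le.1 (Complex.abs_arg_le_pi (expMap lam z))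
  have h2 := abs_le.1 (Complex.abs_arg_le_pi lam)
  rw [abs_le]
  constructor <;> linarith

theorem ediam_le_of_norm_le {T E : Set ℂ} {g : ℂ → ℂ} {c : ℝ} (hc : 0 ≤ c)
    (hg : ∀ u ∈ T, g u ∈ E) (h : ∀ u ∈ T, ∀ v ∈ T, ‖u - v‖ ≤ c * ‖g u - g v‖) :
    Metric.ediam T ≤ ENNReal.ofReal c * Metric.ediam E := by
  refine Metric.ediam_le fun u hu v hv => ?_
  have h1 : edist u v ≤ ENNReal.ofReal c * edist (g u) (g v) := by
    rw [edist_dist, edist_dist, ← ENNReal.ofReal_mul hc, dist_eq_norm, dist_eq_norm]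
    exact ENNReal.ofReal_le_ofReal (h u hu v hv)
  refine h1.trans ?_
  gcongr
  exact Metric.edist_le_ediam_of_mem (hg u hu) (hg v hv)

theorem norm_sub_le_of_branchIndex_eq (hlam : lam ≠ 0) {u v : ℂ}
    (h : branchIndex lam u = branchIndex lam v) {c : ℝ} (hc : 0 < c)
    (hu : c ≤ (expMap lam u).re) (hv : c ≤ (expMap lam v).re) :
    ‖u - v‖ ≤ c⁻¹ * ‖expMap lam u - expMap lam v‖ := by
  rw [sub_eq_log_sub_log hlam h]
  exact norm_log_sub_log_le (convex_halfSpace_re_ge c) hc (fun w hw => hc.trans_le hw)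
    (fun w hw => le_trans hw (Complex.re_le_norm w)) hu hv

/-- A sharper contraction estimate when the images lie in a common fundamental strip. -/
theorem norm_sub_le_of_branchIndex_eq' (hlam : lam ≠ 0) {u v : ℂ}
    (h : branchIndex lam u = branchIndex lam v)
    (h' : branchIndex lam (expMap lam u) = branchIndex lam (expMap lam v))
    (hu : 1 ≤ (expMap lam u).re) (hv : 1 ≤ (expMap lam v).re) :
    ‖u - v‖ ≤ 2 / (|(branchIndex lam (expMap lam u) : ℝ)| + 1) *
      ‖expMap lam u - expMap lam v‖ := by
  set n := branchIndex lam (expMap lam u)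
  have hc : (0 : ℝ) < (|(n : ℝ)| + 1) / 2 := by positivity
  have hpi := Real.pi_gt_three
  have h1 := abs_le.1 (abs_im_sub_branchIndex_le hlam (expMap lam u))
  have h2 := abs_le.1 (abs_im_sub_branchIndex_le hlam (expMap lam v))
  rw [← h'] at h2
  change -(2 * Real.pi) ≤ _ - 2 * Real.pi * (n : ℝ) ∧ _ - 2 * Real.pi * (n : ℝ) ≤ _ at h1
  rw [sub_eq_log_sub_log hlam h, ← inv_div]
  -- For |n| ≥ 2 the height, at least 2π(|n|-1), bounds the modulus below by (|n|+1)/2. For |n| ≤ 1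
  -- the bound Re ≥ 1 does so.
  rcases le_or_gt 2 n with hn | hn
  · have hn' : (2 : ℝ) ≤ n := by exact_mod_cast hn
    have ha : |(n : ℝ)| = n := abs_of_nonneg (by linarith)
    refine norm_log_sub_log_le ((convex_halfSpace_re_gt 0).inter
      (convex_halfSpace_im_ge ((|(n : ℝ)| + 1) / 2))) hc (fun w hw => hw.1)
      (fun w hw => le_trans hw.2 ((le_abs_self _).trans (Complex.abs_im_le_norm w)))
      ⟨by simp only [mem_ofPred_eq]; linarith, ?_⟩ ⟨by simp only [mem_ofPred_eq]; linarith, ?_⟩ <;>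
    · simp only [mem_ofPred_eq, ha]
      nlinarith
  rcases le_or_gt n (-2) with hn2 | hn2
  · have hn' : (n : ℝ) ≤ -2 := by exact_mod_cast hn2
    have ha : |(n : ℝ)| = -n := abs_of_nonpos (by linarith)
    refine norm_log_sub_log_le ((convex_halfSpace_re_gt 0).inter
      (convex_halfSpace_im_le (-((|(n : ℝ)| + 1) / 2)))) hc (fun w hw => hw.1)
      (fun w hw => ?_)
      ⟨by simp only [mem_ofPred_eq]; linarith, ?_⟩ ⟨by simp only [mem_ofPred_eq]; linarith, ?_⟩
    · have h3 : w.im ≤ -((|(n : ℝ)| + 1) / 2) := hw.2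
      have h4 := neg_abs_le w.im
      have h5 := Complex.abs_im_le_norm w
      linarith
    all_goals
      simp only [mem_ofPred_eq, ha]
      nlinarith
  · have hn3 : |n| ≤ 1 := abs_le.2 ⟨by omega, by omega⟩
    have hn4 : |(n : ℝ)| ≤ 1 := by exact_mod_cast hn3
    refine norm_log_sub_log_le (convex_halfSpace_re_ge 1) hc (fun w hw => one_pos.trans_le hw)
      (fun w hw => ?_) hu hv
    have h3 : 1 ≤ w.re := hw
    have := Complex.re_le_norm w
    linarith

/-- The indices of inverse branches that are possible on a horizontal strip of height `B`. -/
theorem branchIndex_mem_Icc (hlam : lam ≠ 0) {B : ℝ} {z : ℂ} (hz : |z.im| ≤ B) :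
    branchIndex lam z ∈ Finset.Icc (-⌈B + 1⌉) ⌈B + 1⌉ := by
  have hpi := Real.pi_gt_three
  have h1 := abs_le.1 (abs_im_sub_branchIndex_le hlam z)
  have h2 := abs_le.1 hz
  have h3 := Int.le_ceil (B + 1)
  rw [Finset.mem_Icc]
  have hB : 0 ≤ B := (abs_nonneg _).trans hz
  constructor
  · have h4 : -(B + 1) ≤ (branchIndex lam z : ℝ) := by
      by_contra! h
      nlinarith
    have h5 : ((-⌈B + 1⌉ : ℤ) : ℝ) ≤ branchIndex lam z := by push_cast; linarith
    exact_mod_cast h5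
  · have h4 : (branchIndex lam z : ℝ) ≤ B + 1 := by
      by_contra! h
      nlinarith
    have h5 : (branchIndex lam z : ℝ) ≤ (⌈B + 1⌉ : ℤ) := by linarith
    exact_mod_cast h5

end UpperBound

/-! ### Refining covers over one turn of the cycle -/

section Covers

variable {lam : ℂ}

/-- The number of inverse branches available on a strip of height `B`. -/
noncomputable def branchCount (B : ℝ) : ℝ≥0∞ := (Finset.Icc (-⌈B + 1⌉) ⌈B + 1⌉).card

/-- The sum of the `s`-th powers of the contraction rates of all inverse branches. -/
noncomputable def branchSum (s : ℝ) : ℝ≥0∞ := ∑' n : ℤ, ENNReal.ofReal (2 / (|(n : ℝ)| + 1)) ^ s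

theorem branchSum_ne_top {s : ℝ} (hs : 1 < s) : branchSum s ≠ ⊤ := by
  have h1 : Summable fun n : ℤ => (2 / (|(n : ℝ)| + 1)) ^ s := by
    -- The shift by 1/2 avoids a zero denominator and satisfies |n + 1/2| ≤ |n| + 1.
    refine Summable.of_nonneg_of_le (fun n => by positivity) (fun n => ?_)
      (((Real.summable_one_div_int_add_rpow (1 / 2) s).2 hs).mul_left (2 ^ s))
    rw [Real.div_rpow two_pos.le (by positivity), mul_one_div]
    have h2 : (0 : ℝ) < |(n : ℝ) + 1 / 2| := by
      rw [abs_pos]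
      intro h
      have h3 : (2 * n + 1 : ℤ) = 0 := by
        have : (2 * n + 1 : ℝ) = 0 := by linarith
        exact_mod_cast this
      omega
    have h3 : |(n : ℝ) + 1 / 2| ≤ |(n : ℝ)| + 1 := by
      refine (abs_add_le _ _).trans ?_
      rw [abs_of_pos (by norm_num : (0 : ℝ) < 1 / 2)]
      linarith
    gcongr
  have h2 : branchSum s = ∑' n : ℤ, ENNReal.ofReal ((2 / (|(n : ℝ)| + 1)) ^ s) := by
    unfold branchSum
    exact tsum_congr fun n => ENNReal.ofReal_rpow_of_nonneg (by positivity) (by linarith)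
  rw [h2]
  exact h1.tsum_ofReal_ne_top

/-- At a bounded time only finitely many branches occur, and each is 1-Lipschitz because its
argument has real part at least 1. -/
theorem one_step_cover (hlam : lam ≠ 0) {p : ℕ} {B M s : ℝ} {r : ℕ} (hr : r % p ≠ 0)
    (hM : 1 ≤ M) (hs : 0 ≤ s) {δ S : ℝ≥0∞} (h : HasCover s (returnSet lam p B M (r + 1)) δ S) :
    HasCover s (returnSet lam p B M r) δ (branchCount B * S) := by
  rw [← one_mul δ]
  refine h.refine (g := expMap lam) (fun w hw => map_returnSet hw)
    (β := Finset.Icc (-⌈B + 1⌉) ⌈B + 1⌉) (fun E hE => ?_) hs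
  have hdiam : ∀ c : ℤ, Metric.ediam {u | u ∈ returnSet lam p B M r ∧ expMap lam u ∈ E ∧
      branchIndex lam u = c} ≤ 1 * Metric.ediam E := by
    intro c
    have := ediam_le_of_norm_le (T := {u | u ∈ returnSet lam p B M r ∧ expMap lam u ∈ E ∧
      branchIndex lam u = c}) (E := E) (g := expMap lam) zero_le_one (fun u hu => hu.2.1)
      fun u hu v hv => by
        have h1 := norm_sub_le_of_branchIndex_eq hlam (hu.2.2.trans hv.2.2.symm) one_pos
          (hM.trans (map_returnSet hu.1 0).1) (hM.trans (map_returnSet hv.1 0).1)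
        simpa using h1
    simpa using this
  refine ⟨fun c => {u | u ∈ returnSet lam p B M r ∧ expMap lam u ∈ E ∧ branchIndex lam u = c},
    ?_, fun c => hdiam c, ?_⟩
  · rintro u ⟨hu, huE⟩
    have h1 := (hu 0).2 (by simpa using hr)
    exact mem_iUnion.2 ⟨⟨_, branchIndex_mem_Icc hlam h1⟩, hu, huE, rfl⟩
  · calc _ ≤ ∑' _ : Finset.Icc (-⌈B + 1⌉) ⌈B + 1⌉, Metric.ediam E ^ s := by
          refine ENNReal.tsum_le_tsum fun c => ?_
          have := hdiam c
          rw [one_mul] at this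
          gcongr
      _ = _ := by
          rw [tsum_fintype, Finset.sum_const, nsmul_eq_mul, Finset.card_univ, Fintype.card_coe]
          rfl

/-- The first pull-back may use any branch n and contracts by 1/m. The second uses finitely many
branches and contracts by 2/(|n|+1), since its argument has height about 2πn. Taken together, the
two steps make the sum over n converge. -/
theorem two_step_cover (hlam : lam ≠ 0) {p : ℕ} {B M s : ℝ} {r : ℕ} (hr : r % p ≠ 0)
    (hM : 1 ≤ M) (hs : 0 ≤ s) {m : ℝ} (hm : 1 ≤ m) {E : Set ℂ} (hE : ∀ w ∈ E, m ≤ w.re) :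
    ∃ T : Finset.Icc (-⌈B + 1⌉) ⌈B + 1⌉ × ℤ → Set ℂ,
      returnSet lam p B M r ∩ (expMap lam)^[2] ⁻¹' E ⊆ ⋃ b, T b ∧
      (∀ b, Metric.ediam (T b) ≤ ENNReal.ofReal (2 / m) * Metric.ediam E) ∧
      ∑' b, Metric.ediam (T b) ^ s ≤
        branchCount B * branchSum s * ENNReal.ofReal (1 / m) ^ s * Metric.ediam E ^ s := by
  have hm0 : 0 < m := by linarith
  have hdiam : ∀ c n : ℤ, Metric.ediam {u | u ∈ returnSet lam p B M r ∧
      (expMap lam)^[2] u ∈ E ∧ branchIndex lam u = c ∧ branchIndex lam (expMap lam u) = n} ≤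
      ENNReal.ofReal (2 / (|(n : ℝ)| + 1)) * ENNReal.ofReal (1 / m) * Metric.ediam E := by
    intro c n
    rw [← ENNReal.ofReal_mul (by positivity)]
    refine ediam_le_of_norm_le (g := (expMap lam)^[2]) (by positivity) (fun u hu => hu.2.1)
      fun u hu v hv => ?_
    obtain ⟨hu1, hu2, hu3, hu4⟩ := hu
    obtain ⟨hv1, hv2, hv3, hv4⟩ := hv
    have h1 := norm_sub_le_of_branchIndex_eq' hlam (hu3.trans hv3.symm) (hu4.trans hv4.symm)
      (hM.trans (map_returnSet hu1 0).1) (hM.trans (map_returnSet hv1 0).1)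
    have h2 := norm_sub_le_of_branchIndex_eq hlam (hu4.trans hv4.symm) hm0
      (hE _ hu2) (hE _ hv2)
    rw [hu4] at h1
    calc ‖u - v‖ ≤ _ := h1
      _ ≤ 2 / (|(n : ℝ)| + 1) * (m⁻¹ * _) := by gcongr
      _ = _ := by rw [one_div, mul_assoc]; rfl
  refine ⟨fun b => {u | u ∈ returnSet lam p B M r ∧ (expMap lam)^[2] u ∈ E ∧
    branchIndex lam u = b.1 ∧ branchIndex lam (expMap lam u) = b.2}, ?_, fun b => ?_, ?_⟩
  · rintro u ⟨hu, huE⟩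
    have h1 := (hu 0).2 (by simpa using hr)
    exact mem_iUnion.2 ⟨⟨⟨_, branchIndex_mem_Icc hlam h1⟩, _⟩, hu, huE, rfl, rfl⟩
  · refine (hdiam b.1 b.2).trans ?_
    rw [← ENNReal.ofReal_mul (by positivity)]
    gcongr
    rw [← mul_one_div 2 m]
    gcongr
    exact div_le_self two_pos.le (by linarith [abs_nonneg (b.2 : ℝ)])
  · calc _ ≤ ∑' b : Finset.Icc (-⌈B + 1⌉) ⌈B + 1⌉ × ℤ,
          (ENNReal.ofReal (2 / (|(b.2 : ℝ)| + 1)) * ENNReal.ofReal (1 / m) *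
            Metric.ediam E) ^ s := by
          refine ENNReal.tsum_le_tsum fun b => ?_
          have := hdiam b.1 b.2
          gcongr
      _ = ∑' _ : Finset.Icc (-⌈B + 1⌉) ⌈B + 1⌉, ∑' n : ℤ,
          (ENNReal.ofReal (2 / (|(n : ℝ)| + 1)) * ENNReal.ofReal (1 / m) *
            Metric.ediam E) ^ s := ENNReal.tsum_prod (f := fun _ (n : ℤ) =>
              (ENNReal.ofReal (2 / (|(n : ℝ)| + 1)) * ENNReal.ofReal (1 / m) *
                Metric.ediam E) ^ s)
      _ = _ := by
          rw [tsum_fintype, Finset.sum_const, nsmul_eq_mul, Finset.card_univ, Fintype.card_coe]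
          simp_rw [ENNReal.mul_rpow_of_nonneg _ _ hs]
          rw [ENNReal.tsum_mul_right, ENNReal.tsum_mul_right]
          simp only [branchCount, branchSum]
          ring

theorem descend_cover (hlam : lam ≠ 0) {p : ℕ} {B M s : ℝ} (hM : 1 ≤ M) (hs : 0 ≤ s)
    {δ S : ℝ≥0∞} {j : ℕ} (hj : j + 1 < p) (h : HasCover s (returnSet lam p B M (j + 1)) δ S) :
    HasCover s (returnSet lam p B M 1) δ (branchCount B ^ j * S) := by
  induction j generalizing S with
  | zero => simpa using h
  | succ j ih =>
    have := ih (by omega) (one_step_cover hlam (r := j + 1)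
      (by rw [Nat.mod_eq_of_lt (by omega)]; omega) hM hs h)
    rwa [← mul_assoc, ← pow_succ] at this

/-- A half-strip has infinite total diameter when cut into boxes of unit width. After a two-step
pull-back the box at distance M+i contributes a multiple of (M+i)^(-s), which is summable. -/
theorem exists_initial_cover (hlam : lam ≠ 0) {p : ℕ} (hp : 1 < p) {B M s : ℝ} (hM : 1 ≤ M)
    (hs : 1 < s) : ∃ δ S : ℝ≥0∞, δ ≠ ⊤ ∧ S ≠ ⊤ ∧ HasCover s (returnSet lam p B M 1) δ S := by
  have hs0 : 0 ≤ s := by linarith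
  let R : ℕ → Set ℂ := fun i => {w | M + i ≤ w.re ∧ w.re ≤ M + i + 1 ∧ |w.im| ≤ B}
  have hR : ∀ i, Metric.ediam (R i) ≤ ENNReal.ofReal (1 + 2 * B) := by
    intro i
    refine Metric.ediam_le fun u hu v hv => ?_
    rw [edist_dist, dist_eq_norm]
    refine ENNReal.ofReal_le_ofReal ((Complex.norm_le_abs_re_add_abs_im _).trans ?_)
    have h1 := abs_le.1 hu.2.2
    have h2 := abs_le.1 hv.2.2
    have h3 : |(u - v).re| ≤ 1 := by
      rw [Complex.sub_re, abs_le]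
      constructor <;> linarith [hu.1, hu.2.1, hv.1, hv.2.1]
    have h4 : |(u - v).im| ≤ 2 * B := by
      rw [Complex.sub_im, abs_le]
      constructor <;> linarith
    linarith
  have hpm : (p - 1) % p ≠ 0 := by rw [Nat.mod_eq_of_lt (by omega)]; omega
  have hm : ∀ i : ℕ, 1 ≤ M + i := fun i => by linarith [(Nat.cast_nonneg i : (0 : ℝ) ≤ i)]
  choose T hT hTδ hTs using fun i : ℕ => two_step_cover (lam := lam) (p := p) (B := B) (M := M)
    (s := s) hlam hpm hM hs0 (hm i) (E := R i) fun w hw => hw.1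
  have hcov : HasCover s (returnSet lam p B M (p - 2 + 1)) (2 * ENNReal.ofReal (1 + 2 * B))
      (branchCount B * branchSum s * ENNReal.ofReal (1 + 2 * B) ^ s *
        ∑' i : ℕ, ENNReal.ofReal (1 / (M + i)) ^ s) := by
    refine ⟨ℕ × (Finset.Icc (-⌈B + 1⌉) ⌈B + 1⌉ × ℤ), inferInstance, fun q => T q.1 q.2, ?_, ?_,
      ?_⟩
    · intro w hw
      rw [show p - 2 + 1 = p - 1 by omega] at hw
      have h1 := map_returnSet (map_returnSet hw) 0
      have h2 := h1.2 (by
        rw [zero_add, show p - 1 + 1 + 1 = 1 + p by omega, Nat.add_mod_right,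
          Nat.mod_eq_of_lt hp]
        exact one_ne_zero)
      have h3 : 0 ≤ ((expMap lam)^[2] w).re - M := sub_nonneg.2 h1.1
      have h4 : w ∈ ⋃ b, T ⌊((expMap lam)^[2] w).re - M⌋₊ b := by
        refine hT _ ⟨hw, ?_, ?_, h2⟩
        · have := Nat.floor_le h3
          linarith
        · have := (Nat.lt_floor_add_one (((expMap lam)^[2] w).re - M)).le
          linarith
      obtain ⟨b, hb⟩ := mem_iUnion.1 h4
      exact mem_iUnion.2 ⟨⟨_, b⟩, hb⟩
    · rintro ⟨i, b⟩
      refine (hTδ i b).trans ?_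
      refine mul_le_mul' ?_ (hR i)
      rw [← ENNReal.ofReal_ofNat]
      exact ENNReal.ofReal_le_ofReal (div_le_self two_pos.le (hm i))
    · calc _ = ∑' i, ∑' b, Metric.ediam (T i b) ^ s :=
            ENNReal.tsum_prod (f := fun i b => Metric.ediam (T i b) ^ s)
        _ ≤ ∑' i : ℕ, branchCount B * branchSum s * ENNReal.ofReal (1 + 2 * B) ^ s *
            ENNReal.ofReal (1 / (M + i)) ^ s := by
          refine ENNReal.tsum_le_tsum fun i => (hTs i).trans ?_
          rw [mul_right_comm]
          have := hR i
          gcongr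
        _ = _ := ENNReal.tsum_mul_left
  refine ⟨_, _, ?_, ?_, descend_cover hlam hM hs0 (by omega) hcov⟩
  · exact ENNReal.mul_ne_top (by simp) ENNReal.ofReal_ne_top
  · have h1 : branchCount B ≠ ⊤ := ENNReal.natCast_ne_top _
    have h2 : ∑' i : ℕ, ENNReal.ofReal (1 / (M + i)) ^ s ≠ ⊤ := by
      have h3 : Summable fun i : ℕ => (1 / (M + i)) ^ s := by
        refine ((Real.summable_one_div_nat_add_rpow M s).2 hs).congr fun i => ?_
        rw [Real.div_rpow zero_le_one (by linarith [hm i]), Real.one_rpow, add_comm (i : ℝ),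
          abs_of_nonneg (by linarith [hm i])]
      have h4 := h3.tsum_ofReal_ne_top
      refine ne_of_eq_of_ne (tsum_congr fun i => ?_) h4
      exact ENNReal.ofReal_rpow_of_nonneg (by have := hm i; positivity) hs0
    refine ENNReal.mul_ne_top (ENNReal.pow_ne_top h1) (ENNReal.mul_ne_top (ENNReal.mul_ne_top
      (ENNReal.mul_ne_top h1 (branchSum_ne_top hs)) ?_) h2)
    exact ENNReal.rpow_ne_top_of_nonneg hs0 ENNReal.ofReal_ne_top

theorem improve_cover (hlam : lam ≠ 0) {p : ℕ} (hp : 1 < p) {B M s : ℝ} (hM : 1 ≤ M)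
    (hs : 0 ≤ s) {δ S : ℝ≥0∞} (h : HasCover s (returnSet lam p B M 1) δ S) :
    HasCover s (returnSet lam p B M 1) (ENNReal.ofReal (2 / M) * δ)
      (branchCount B ^ (p - 2) * (branchCount B * branchSum s * ENNReal.ofReal (1 / M) ^ s * S)) := by
  refine descend_cover hlam hM hs (by omega) ?_
  have hmap : MapsTo (expMap lam)^[2] (returnSet lam p B M (p - 2 + 1))
      (returnSet lam p B M 1) := by
    intro w hw
    have := map_returnSet (map_returnSet hw)
    rw [show p - 2 + 1 + 1 + 1 = 1 + p by omega, returnSet_add_period] at this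
    exact this
  refine h.refine hmap (fun E hE => two_step_cover hlam ?_ hM hs hM fun w hw => ?_) hs
  · rw [Nat.mod_eq_of_lt (by omega)]; omega
  · exact (hE hw 0).1

theorem hausdorffMeasure_eq_zero_of_hasCover {s : ℝ} {X : Set ℂ} {δ S : ℝ≥0∞} (hδ : δ ≠ ⊤)
    (hS : S ≠ ⊤) (h : ∀ l : ℕ, HasCover s X (2⁻¹ ^ l * δ) (2⁻¹ ^ l * S)) :
    MeasureTheory.Measure.hausdorffMeasure s X = 0 := by
  have hlim : ∀ c : ℝ≥0∞, c ≠ ⊤ → Tendsto (fun l : ℕ => (2⁻¹ : ℝ≥0∞) ^ l * c) atTop (𝓝 0) := by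
    intro c hc
    have h1 := ENNReal.tendsto_pow_atTop_nhds_zero_of_lt_one
      (r := 2⁻¹) (by simp [ENNReal.inv_lt_one])
    simpa using ENNReal.Tendsto.mul_const h1 (Or.inr hc)
  choose ι hι E hE hEδ hES using h
  have h1 := MeasureTheory.Measure.hausdorffMeasure_le_liminf_tsum s X (l := atTop) _ (hlim δ hδ)
    E (Eventually.of_forall hEδ) (Eventually.of_forall hE)
  refine le_antisymm (h1.trans ?_) bot_le
  refine (liminf_le_liminf (Eventually.of_forall hES)).trans ?_
  rw [(hlim S hS).liminf_eq]

theorem exists_dimH_returnSet_le (hlam : lam ≠ 0) {p : ℕ} (hp : 1 < p) (B : ℝ) {s : ℝ≥0}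
    (hs : 1 < s) : ∃ M : ℝ, dimH (returnSet lam p B M 1) ≤ s := by
  have hs' : (1 : ℝ) < s := by exact_mod_cast hs
  have hs0 : (0 : ℝ) ≤ s := s.2
  set C : ℝ≥0∞ := branchCount B ^ (p - 2) * (branchCount B * branchSum s) with hC
  have hCt : C ≠ ⊤ := by
    have h1 : branchCount B ≠ ⊤ := ENNReal.natCast_ne_top _
    exact ENNReal.mul_ne_top (ENNReal.pow_ne_top h1)
      (ENNReal.mul_ne_top h1 (branchSum_ne_top hs'))
  -- M ≥ 4 makes the mesh factor 2/M at most 1/2; the other condition does the same for the sum.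
  obtain ⟨M, hM, hMC⟩ : ∃ M : ℝ, 4 ≤ M ∧ C * ENNReal.ofReal (1 / M) ^ (s : ℝ) ≤ 2⁻¹ := by
    have h1 : Tendsto (fun M : ℝ => C * ENNReal.ofReal (1 / M)) atTop (𝓝 0) := by
      have h2 : Tendsto (fun M : ℝ => 1 / M) atTop (𝓝 0) := by
        simpa using tendsto_inv_atTop_zero (𝕜 := ℝ)
      have h3 := (ENNReal.continuous_ofReal.tendsto 0).comp h2
      rw [ENNReal.ofReal_zero] at h3
      simpa using ENNReal.Tendsto.const_mul h3 (Or.inr hCt)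
    obtain ⟨M, h2, h3⟩ := ((h1.eventually_le_const
      (show (0 : ℝ≥0∞) < 2⁻¹ by simp)).and (eventually_ge_atTop 4)).exists
    refine ⟨M, h3, le_trans ?_ h2⟩
    gcongr
    refine (ENNReal.rpow_le_rpow_of_exponent_ge ?_ hs'.le).trans_eq (ENNReal.rpow_one _)
    rw [ENNReal.ofReal_le_one, div_le_one (by linarith)]
    linarith
  refine ⟨M, ?_⟩
  obtain ⟨δ, S, hδ, hS, hcov⟩ := exists_initial_cover (lam := lam) hlam hp (B := B) (M := M)
    (by linarith) hs'
  have hzero := hausdorffMeasure_eq_zero_of_hasCover hδ hS (s := s)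
    (X := returnSet lam p B M 1) fun l => by
      induction l with
      | zero => simpa using hcov
      | succ l ih =>
        obtain ⟨ι, hι, E, h1, h2, h3⟩ := improve_cover hlam hp (by linarith) hs0 ih
        refine ⟨ι, hι, E, h1, fun i => (h2 i).trans ?_, h3.trans ?_⟩
        · rw [pow_succ', mul_assoc]
          gcongr
          rw [← ENNReal.ofReal_ofNat, ← ENNReal.ofReal_inv_of_pos two_pos]
          refine ENNReal.ofReal_le_ofReal ?_
          rw [div_le_iff₀ (by linarith)]
          linarith
        · calc _ = C * ENNReal.ofReal (1 / M) ^ (s : ℝ) * (2⁻¹ ^ l * S) := by rw [hC]; ring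
            _ ≤ 2⁻¹ * (2⁻¹ ^ l * S) := mul_le_mul' hMC le_rfl
            _ = _ := by ring
  exact dimH_le_of_hausdorffMeasure_ne_top (by rw [hzero]; exact ENNReal.zero_ne_top)

end Covers

/-! ### The upper bound -/

section Upper

variable {lam : ℂ} {p : ℕ} {z₀ : ℂ}

theorem re_tendsto_of_mem_escapingSet (hlam : lam ≠ 0) {z : ℂ}
    (hz : z ∈ escapingSet (expMap lam)) :
    Tendsto (fun n => ((expMap lam)^[n] z).re) atTop atTop := by
  have h1 : Tendsto (fun n => ‖(expMap lam)^[n + 1] z‖) atTop atTop :=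
    (tendsto_norm_cobounded_atTop.comp hz).comp (tendsto_add_atTop_nat 1)
  have hl : 0 < ‖lam‖ := norm_pos_iff.2 hlam
  have h2 : Tendsto (fun n => Real.log (‖lam‖⁻¹ * ‖(expMap lam)^[n + 1] z‖)) atTop atTop :=
    Real.tendsto_log_atTop.comp (h1.const_mul_atTop (inv_pos.2 hl))
  refine h2.congr fun n => ?_
  rw [Function.iterate_succ_apply', norm_expMap, inv_mul_cancel_left₀ hl.ne', Real.log_exp]

theorem Construction.dimH_le_one (𝒞 : Construction (expMap lam) p z₀) (hlam : lam ≠ 0)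
    (hp : 1 < p) (hz₀ : IsAttractingPeriodicPt (expMap lam) p z₀) :
    dimH ({z : ℂ | ∃ s ∈ kneadingSequences p 𝒞.k, HasItinerary (expMap lam) 𝒞.H z s} ∩
      escapingSet (expMap lam)) ≤ 1 := by
  obtain ⟨B, hB⟩ := 𝒞.exists_im_bound_kneading hlam hp hz₀
  refine le_of_forall_gt fun d hd => ?_
  obtain ⟨s, hs1, hsd⟩ := ENNReal.lt_iff_exists_nnreal_btwn.1 hd
  refine lt_of_le_of_lt ?_ hsd
  obtain ⟨M, hM⟩ := exists_dimH_returnSet_le (lam := lam) hlam hp B (s := s) (by exact_mod_cast hs1)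
  have hsub : {z : ℂ | ∃ s ∈ kneadingSequences p 𝒞.k, HasItinerary (expMap lam) 𝒞.H z s} ∩
      escapingSet (expMap lam) ⊆
        ⋃ l : ℕ, (expMap lam)^[l * p + 1] ⁻¹' returnSet lam p B M 1 := by
    rintro z ⟨⟨σ, ⟨t, ht⟩, hσ⟩, hz⟩
    obtain ⟨N, hN⟩ := eventually_atTop.1
      ((re_tendsto_of_mem_escapingSet hlam hz).eventually_ge_atTop M)
    refine mem_iUnion.2 ⟨N, fun n => ?_⟩
    rw [← Function.iterate_add_apply]
    -- Time n after the start is time n + Np + 1 of the orbit, so the residue of n + 1 gives the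
    -- place in the kneading block.
    refine ⟨hN _ (by nlinarith), fun hn => ?_⟩
    have h1 : n + (N * p + 1) = (N + (n + 1) / p) * p + (n + 1) % p := by
      have := Nat.div_add_mod' (n + 1) p
      rw [add_mul]
      omega
    have h2 := (ht (N + (n + 1) / p)).2 ((n + 1) % p) (Nat.one_le_iff_ne_zero.2 hn)
      (Nat.mod_lt _ (by omega))
    refine hB _ (Nat.one_le_iff_ne_zero.2 hn) (Nat.mod_lt (n + 1) (by omega)) _ ?_
    rw [← h2, ← h1]
    exact hσ _
  refine (dimH_mono hsub).trans ?_
  rw [dimH_iUnion]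
  exact iSup_le fun l => (dimH_preimage_expMap_iterate_le hlam _ _).trans hM

end Upper

/-! ### Pull-backs of `C p` enlarged by two half-planes -/

section Enlarged

variable {lam : ℂ} {p : ℕ} {z₀ : ℂ}

namespace Construction

variable (𝒞 : Construction (expMap lam) p z₀)

/-- Successive pull-backs along the cycle of the union of `C p` with two half-planes. The `i`-th one
contains `C (p - i)`. -/
def enlarged (B : ℝ) : ℕ → Set ℂ
  | 0 => 𝒞.C p ∪ {w | B < |w.im|}
  | i + 1 => connectedComponentIn (expMap lam ⁻¹' enlarged B i) ((expMap lam)^[p - (i + 1)] z₀)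

variable {𝒞} {B : ℝ}

theorem isOpen_enlarged (i : ℕ) : IsOpen (𝒞.enlarged B i) := by
  induction i with
  | zero =>
    exact (𝒞.isOpen_C le_rfl).union
      (isOpen_lt continuous_const (continuous_abs.comp Complex.continuous_im))
  | succ i ih => exact (ih.preimage continuous_expMap).connectedComponentIn

theorem isPreconnected_enlarged (i : ℕ) : IsPreconnected (𝒞.enlarged B i) := by
  cases i with
  | zero =>
    obtain ⟨c, hc⟩ := 𝒞.isTruncatedDomain.leftHalfPlane
    have h1 : {w : ℂ | B < |w.im|} = {w | B < w.im} ∪ {w | w.im < -B} := by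
      ext w
      simp only [mem_ofPred_eq, mem_union, lt_abs, lt_neg]
    have h2 : ∀ y : ℝ, (⟨c - 1, y⟩ : ℂ) ∈ 𝒞.C p := fun y => hc (by simp)
    change IsPreconnected (𝒞.C p ∪ {w | B < |w.im|})
    rw [h1, ← union_assoc]
    refine IsPreconnected.union ⟨c - 1, -B - 1⟩ (Or.inl (h2 _)) (by simp)
      (IsPreconnected.union ⟨c - 1, B + 1⟩ (h2 _) (by simp) (𝒞.isPreconnected_C le_rfl)
        (convex_halfSpace_im_gt B).isPreconnected) (convex_halfSpace_im_lt (-B)).isPreconnected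
  | succ i => exact isPreconnected_connectedComponentIn

theorem map_enlarged {i : ℕ} {w : ℂ} (hw : w ∈ 𝒞.enlarged B (i + 1)) :
    expMap lam w ∈ 𝒞.enlarged B i := by
  have h : w ∈ expMap lam ⁻¹' 𝒞.enlarged B i := connectedComponentIn_subset _ _ hw
  exact h

theorem iterate_enlarged {i : ℕ} {w : ℂ} (hw : w ∈ 𝒞.enlarged B i) :
    (expMap lam)^[i] w ∈ 𝒞.enlarged B 0 := by
  induction i generalizing w with
  | zero => exact hw
  | succ i ih => exact ih (map_enlarged hw)

theorem mem_enlarged (hz₀ : IsAttractingPeriodicPt (expMap lam) p z₀) {i : ℕ} (hi : i ≤ p) :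
    (expMap lam)^[p - i] z₀ ∈ 𝒞.enlarged B i := by
  induction i with
  | zero => exact Or.inl (𝒞.mem_C hz₀ le_rfl)
  | succ i ih =>
    refine mem_connectedComponentIn ?_
    rw [mem_preimage, ← Function.iterate_succ_apply' (expMap lam),
      show (p - (i + 1)).succ = p - i by omega]
    exact ih (by omega)

theorem C_subset_enlarged (hz₀ : IsAttractingPeriodicPt (expMap lam) p z₀) {i : ℕ} (hi : i ≤ p) :
    𝒞.C (p - i) ⊆ 𝒞.enlarged B i := by
  induction i with
  | zero => exact subset_union_left
  | succ i ih =>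
    refine (𝒞.isPreconnected_C (Nat.sub_le _ _)).subset_connectedComponentIn
      (𝒞.mem_C hz₀ (Nat.sub_le _ _)) fun w hw => ih (by omega) ?_
    have := 𝒞.map_C (j := p - (i + 1)) (by omega) hw
    rwa [show p - (i + 1) + 1 = p - i by omega] at this

theorem exists_mem_enlarged (hlam : lam ≠ 0) (hz₀ : IsAttractingPeriodicPt (expMap lam) p z₀)
    {i : ℕ} (hi : i < p) {v : ℂ} (hv : v ∈ 𝒞.enlarged B i) (hv0 : v ≠ 0) :
    ∃ u ∈ 𝒞.enlarged B (i + 1), expMap lam u = v :=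
  exists_mem_component_of_mem hlam (isOpen_enlarged i) (isPreconnected_enlarged i)
    (map_enlarged (mem_enlarged hz₀ (i := i + 1) hi)) hv hv0

/-- After i steps a point of `C m` is in `C (m + i)`, which is disjoint from `C p` and has |Im| ≤ B.
The added half-planes therefore create no new intersection. -/
theorem disjoint_enlarged (hlam : lam ≠ 0) (hp : 1 < p) (hz₀ : IsAttractingPeriodicPt (expMap lam) p z₀)
    (hB : ∀ j, 1 ≤ j → j < p → ∀ z ∈ 𝒞.H (𝒞.k j), |z.im| ≤ B)
    {i m : ℕ} (h1 : 1 ≤ m + i) (h2 : m + i < p) :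
    Disjoint (𝒞.enlarged B i) (𝒞.C m) := by
  rw [disjoint_left]
  intro w hw hwC
  have h3 := iterate_enlarged hw
  have h4 := 𝒞.iterate_C (i := i) h2.le hwC
  rcases h3 with h3 | h3
  · exact disjoint_left.1 (𝒞.disjoint_C hp hz₀ h2 le_rfl (by omega)) h4 h3
  · exact not_lt.2 (hB _ h1 h2 _ (𝒞.C_subset_H hlam hp hz₀ h1 h2 h4)) h3

theorem enlarged_subset_H (hlam : lam ≠ 0) (hp : 1 < p) (hz₀ : IsAttractingPeriodicPt (expMap lam) p z₀)
    (hB : ∀ j, 1 ≤ j → j < p → ∀ z ∈ 𝒞.H (𝒞.k j), |z.im| ≤ B)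
    {i : ℕ} (h1 : 1 ≤ i) (h2 : i < p) :
    𝒞.enlarged B i ⊆ 𝒞.H (𝒞.k (p - i)) :=
  𝒞.subset_H hlam hp hz₀ (isPreconnected_enlarged i)
    (disjoint_enlarged hlam hp hz₀ hB (by omega) (by omega)) (mem_enlarged hz₀ h2.le)
    (𝒞.kneading _ (by omega) (by omega))

/-- A point far to the left is mapped close to 0, hence into `C 1`, which the previous pull-back
does not meet. -/
theorem exists_re_bound_enlarged (hlam : lam ≠ 0) (hp : 1 < p) (hz₀ : IsAttractingPeriodicPt (expMap lam) p z₀)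
    (hB : ∀ j, 1 ≤ j → j < p → ∀ z ∈ 𝒞.H (𝒞.k j), |z.im| ≤ B) :
    ∃ A : ℝ, ∀ i, 1 ≤ i → i < p → ∀ w ∈ 𝒞.enlarged B i,
    -A ≤ w.re := by
  obtain ⟨ε, hε, hεC⟩ := Metric.isOpen_iff.1 (𝒞.isOpen_C hp.le) 0 (𝒞.zero_mem_C_one hp hz₀)
  have hl : 0 < ‖lam‖ := norm_pos_iff.2 hlam
  refine ⟨-Real.log (ε / ‖lam‖), fun i h1 h2 w hw => ?_⟩
  rw [neg_neg]
  by_contra! hlt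
  obtain ⟨i, rfl⟩ := Nat.exists_eq_add_of_le' h1
  refine disjoint_left.1 (disjoint_enlarged (m := 1) hlam hp hz₀ hB (by omega) (by omega))
    (map_enlarged hw) (hεC ?_)
  rwa [mem_ball_zero_iff, norm_expMap, mul_comm, ← lt_div_iff₀ hl,
    ← Real.lt_log_iff_exp_lt (by positivity)]

/-- A point whose image has large imaginary part belongs to some `H s`. -/
theorem exists_mem_H_of_lt_abs_im (hlam : lam ≠ 0) (hp : 1 < p) (hz₀ : IsAttractingPeriodicPt (expMap lam) p z₀)
    (hB : ∀ j, 1 ≤ j → j < p → ∀ z ∈ 𝒞.H (𝒞.k j), |z.im| ≤ B)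
    {u : ℂ} (hu : B < |(expMap lam u).im|) : ∃ s, u ∈ 𝒞.H s := by
  obtain ⟨u', hu', h⟩ := exists_mem_enlarged hlam hz₀ (i := 0) (by omega)
    (show expMap lam u ∈ 𝒞.enlarged B 0 from Or.inr hu) (expMap_ne_zero hlam u)
  obtain ⟨n, hn⟩ := (expMap_eq_iff hlam).1 h.symm
  -- The first pull-back already covers both half-planes, so u is a 2πi-translate of one of its
  -- points.
  refine ⟨𝒞.k (p - (0 + 1)) + n, ?_⟩
  rw [hn]
  exact (𝒞.add_period_mem_H_iff n).2 (enlarged_subset_H hlam hp hz₀ hB le_rfl hp hu')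

end Construction

end Enlarged

/-! ### Growth of real parts -/

section Growth

variable {lam : ℂ}

theorem exists_growth (hlam : lam ≠ 0) (A B : ℝ) : ∃ R, 0 ≤ R ∧ A ≤ R ∧
    ∀ x, R ≤ x → x + 1 + B ≤ ‖lam‖ * Real.exp x := by
  have hl : 0 < ‖lam‖ := norm_pos_iff.2 hlam
  have h1 : Tendsto (fun x : ℝ => ‖lam‖ * (Real.exp x / x ^ 1)) atTop atTop :=
    (Real.tendsto_exp_div_pow_atTop 1).const_mul_atTop hl
  obtain ⟨R, hR⟩ := eventually_atTop.1 ((h1.eventually_ge_atTop 2).and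
    (eventually_ge_atTop (|1 + B| + 1)))
  refine ⟨max R (max 0 A), le_max_of_le_right (le_max_left _ _),
    le_max_of_le_right (le_max_right _ _), fun x hx => ?_⟩
  obtain ⟨h2, h3⟩ := hR x ((le_max_left _ _).trans hx)
  have h4 := abs_nonneg (1 + B)
  have hx0 : 0 < x := by linarith
  rw [pow_one, ← mul_div_assoc, le_div_iff₀ hx0] at h2
  linarith [le_abs_self (1 + B)]

/-- In a horizontal strip a large modulus means a large |Re|; the lower bound on Re excludes the
left end. -/
theorem add_one_le_re_of_norm {B y : ℝ} {u : ℂ} (hy : y + 1 + B ≤ ‖u‖) (hR : -(y + 1) < u.re)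
    (hB : |u.im| ≤ B) : y + 1 ≤ u.re := by
  have h1 := Complex.norm_le_abs_re_add_abs_im u
  have h2 : y + 1 ≤ |u.re| := by linarith
  rcases le_abs.1 h2 with h | h <;> linarith

theorem exists_norm_iterate_le (lam : ℂ) (K : ℝ) (n : ℕ) : ∃ V : ℝ, ∀ w : ℂ, w.re ≤ K →
    ‖(expMap lam)^[n + 1] w‖ ≤ V := by
  induction n with
  | zero =>
    refine ⟨‖lam‖ * Real.exp K, fun w hw => ?_⟩
    rw [zero_add, Function.iterate_one, norm_expMap]
    gcongr
  | succ n ih =>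
    obtain ⟨V, hV⟩ := ih
    refine ⟨‖lam‖ * Real.exp V, fun w hw => ?_⟩
    rw [Function.iterate_succ_apply', norm_expMap]
    gcongr
    exact (Complex.re_le_norm _).trans (hV w hw)

theorem exists_norm_iterate_le_of_lt (lam : ℂ) (K : ℝ) (p : ℕ) : ∃ V : ℝ, ∀ n, 1 ≤ n → n < p →
    ∀ w : ℂ, w.re ≤ K → ‖(expMap lam)^[n] w‖ ≤ V := by
  choose V hV using exists_norm_iterate_le lam K
  obtain ⟨M, hM⟩ := ((Finset.range p).image V).exists_le
  refine ⟨M, fun n h1 h2 w hw => ?_⟩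
  obtain ⟨n, rfl⟩ := Nat.exists_eq_add_of_le' h1
  exact (hV n w hw).trans (hM _ (Finset.mem_image_of_mem _ (Finset.mem_range.2 (by omega))))

end Growth

/-! ### Quarter-planes and boundary points -/

section Branch

variable {lam : ℂ} {p : ℕ} {z₀ : ℂ}

/-- A closed quarter-plane opening to the right, and upwards or downwards according to the sign
of `σ`. -/
def quarterPlane (a T σ : ℝ) : Set ℂ := {v | a ≤ v.re ∧ T ≤ σ * v.im}

theorem convex_quarterPlane (a T σ : ℝ) : Convex ℝ (quarterPlane a T σ) := by
  refine (convex_halfSpace_re_ge a).inter ?_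
  have h : IsLinearMap ℝ fun v : ℂ => σ * v.im :=
    ⟨fun x y => by simp [mul_add], fun c x => by simp; ring⟩
  exact convex_halfSpace_ge h T

theorem isClosed_quarterPlane (a T σ : ℝ) : IsClosed (quarterPlane a T σ) :=
  (isClosed_le continuous_const Complex.continuous_re).inter
    (isClosed_le continuous_const (continuous_const.mul Complex.continuous_im))

theorem le_abs_im_of_mem_quarterPlane {a T σ : ℝ} (hσ : σ = 1 ∨ σ = -1) {v : ℂ}
    (hv : v ∈ quarterPlane a T σ) : T ≤ |v.im| := by
  rcases hσ with rfl | rfl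
  · have := hv.2
    rw [one_mul] at this
    exact this.trans (le_abs_self _)
  · have := hv.2
    rw [neg_one_mul] at this
    exact this.trans (neg_le_abs _)

namespace Construction

variable (𝒞 : Construction (expMap lam) p z₀)

theorem exists_re_le_of_mem_C_top (hlam : lam ≠ 0) :
    ∃ c : ℝ, ∀ w ∈ closure (𝒞.C p), w.re ≤ c := by
  obtain ⟨K, hK⟩ := 𝒞.isInitialDomain.isBounded.exists_norm_le
  have hl : 0 < ‖lam‖ := norm_pos_iff.2 hlam
  refine ⟨Real.log ((|K| + 1) / ‖lam‖), fun w hw => ?_⟩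
  have hcl : IsClosed {w : ℂ | w.re ≤ Real.log ((|K| + 1) / ‖lam‖)} :=
    isClosed_le Complex.continuous_re continuous_const
  refine closure_minimal (fun u hu => ?_) hcl hw
  have h1 := hK _ (𝒞.isTruncatedDomain.subset_preimage hu)
  rw [norm_expMap] at h1
  rw [mem_ofPred_eq, Real.le_log_iff_exp_le (by positivity), le_div_iff₀ hl]
  linarith [le_abs_self K]

/-- Quarter-planes to the right of the vertical ends of the boundary of `C p`. -/
theorem exists_quarterPlane_disjoint (hlam : lam ≠ 0) {σ : ℝ} (hσ : σ = 1 ∨ σ = -1) {T : ℝ}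
    (hT : 𝒞.L₂ < T) : ∃ a : ℝ, Disjoint (quarterPlane a T σ) (𝒞.C p) ∧
      ∀ w ∈ frontier (𝒞.C p), T ≤ σ * w.im → w ∈ quarterPlane a T σ := by
  obtain ⟨a, ha⟩ : ∃ a : ℝ, ∀ w : ℂ, 𝒞.L₂ < σ * w.im → (w ∈ frontier (𝒞.C p) ↔ w.re = a) := by
    rcases hσ with rfl | rfl
    · obtain ⟨a, ha⟩ := 𝒞.isTruncatedDomain.vertical_top
      refine ⟨a, fun w hw => ?_⟩
      rw [one_mul] at hw
      have h := Set.ext_iff.1 ha w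
      simp only [mem_inter_iff, mem_ofPred_eq, hw, and_true] at h
      exact h
    · obtain ⟨a, ha⟩ := 𝒞.isTruncatedDomain.vertical_bot
      refine ⟨a, fun w hw => ?_⟩
      rw [neg_one_mul] at hw
      have h := Set.ext_iff.1 ha w
      simp only [mem_inter_iff, mem_ofPred_eq, show w.im < -𝒞.L₂ by linarith, and_true] at h
      exact h
  have hσ2 : σ * σ = 1 := by rcases hσ with rfl | rfl <;> norm_num
  obtain ⟨c, hc⟩ := 𝒞.exists_re_le_of_mem_C_top hlam
  have hopen := 𝒞.isOpen_C le_rfl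
  refine ⟨a, ?_, fun w hw hwT => ⟨((ha w (by linarith)).1 hw).ge, hwT⟩⟩
  rw [disjoint_left]
  intro v hv hvC
  have h1 : 𝒞.L₂ < σ * v.im := hT.trans_le hv.2
  have h2 : v.re ≠ a := fun h => by
    have := (ha v h1).2 h
    rw [hopen.frontier_eq] at this
    exact this.2 hvC
  have h3 : a < v.re := lt_of_le_of_ne hv.1 h2.symm
  -- A point of `C p` to the right of the vertical end would bring its whole rightward ray into `C
  -- p`, where real parts are bounded.
  let S : Set ℂ := (fun t : ℝ => v + (t : ℂ)) '' Ici 0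
  have hS : IsPreconnected S := isPreconnected_Ici.image _ (by fun_prop)
  have hSC : S ⊆ 𝒞.C p := by
    refine IsPreconnected.subset_of_disjoint_frontier hS ⟨v, ⟨0, self_mem_Ici, by simp⟩, hvC⟩ ?_
    rw [disjoint_left]
    rintro _ ⟨t, ht, rfl⟩ hfr
    have ht' : (0 : ℝ) ≤ t := ht
    have := (ha (v + (t : ℂ)) (by simpa using h1)).1 hfr
    rw [Complex.add_re, Complex.ofReal_re] at this
    linarith
  have h4 := hc _ (subset_closure (hSC ⟨|c - v.re| + 1, by simp; positivity, rfl⟩))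
  rw [Complex.add_re, Complex.ofReal_re] at h4
  linarith [le_abs_self (c - v.re)]

/-- The top point of `C 1` on a vertical line far to the right. -/
theorem exists_top_point (hlam : lam ≠ 0) (hp : 1 < p)
    (hz₀ : IsAttractingPeriodicPt (expMap lam) p z₀) : ∃ x₀ : ℝ, ∀ x, x₀ ≤ x → ∃ Y : ℝ,
      (⟨x, Y⟩ : ℂ) ∈ closure (𝒞.C 1) ∧ ∀ y, Y ≤ y → (⟨x, y⟩ : ℂ) ∉ 𝒞.C 1 := by
  obtain ⟨γ, -, hγ, hγC, -, hγr⟩ := 𝒞.exists_curve hlam hz₀ (j := 1) (by omega) hp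
  obtain ⟨B, hB⟩ := 𝒞.exists_im_bound hlam hp hz₀ (𝒞.k 1)
  refine ⟨(γ 0).re, fun x hx => ?_⟩
  have hcont : Continuous fun y : ℝ => (⟨x, y⟩ : ℂ) := by
    have : (fun y : ℝ => (⟨x, y⟩ : ℂ)) = fun y : ℝ => (x : ℂ) + y * Complex.I := by
      funext y; apply Complex.ext <;> simp
    rw [this]; fun_prop
  -- The vertical slice is nonempty by the curve in `C 1`, and bounded because `C 1` lies in one `H
  -- s`. It is open, so its supremum is not attained.
  let S : Set ℝ := {y | (⟨x, y⟩ : ℂ) ∈ 𝒞.C 1}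
  have hSo : IsOpen S := (𝒞.isOpen_C hp.le).preimage hcont
  have hne : S.Nonempty := by
    obtain ⟨t, ht⟩ := mem_range_of_exists_le_of_exists_ge
      (f := fun t => (γ t).re) (Complex.continuous_re.comp hγ) ⟨0, hx⟩
      (hγr.eventually_ge_atTop x).exists
    refine ⟨(γ t).im, ?_⟩
    have : (⟨x, (γ t).im⟩ : ℂ) = γ t := Complex.ext ht.symm rfl
    change (⟨x, (γ t).im⟩ : ℂ) ∈ 𝒞.C 1
    rw [this]
    exact hγC t
  have hbdd : BddAbove S := ⟨B, fun y hy => (le_abs_self _).trans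
    (hB _ (𝒞.C_subset_H hlam hp hz₀ le_rfl hp hy))⟩
  refine ⟨sSup S, map_mem_closure hcont (csSup_mem_closure hne hbdd) fun y hy => hy,
    fun y hy hyS => ?_⟩
  obtain ⟨ε, hε, hball⟩ := Metric.isOpen_iff.1 hSo y hyS
  have h1 : y + ε / 2 ∈ S := hball (by
    rw [Metric.mem_ball, Real.dist_eq, add_sub_cancel_left, abs_of_pos (half_pos hε)]
    linarith)
  linarith [le_csSup hbdd h1]

end Construction

end Branch

/-! ### The inverse branch of f^(p-1) on a quarter-plane -/

section ReturnBranch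

variable {lam : ℂ} {p : ℕ} {z₀ : ℂ}

namespace Construction

variable {𝒞 : Construction (expMap lam) p z₀} {B : ℝ}

theorem map_mem_closure_C {j : ℕ} (hj : j < p) {q : ℂ} (hq : q ∈ closure (𝒞.C j))
    (hq' : q ∉ 𝒞.C j) : expMap lam q ∈ closure (𝒞.C (j + 1)) ∧ expMap lam q ∉ 𝒞.C (j + 1) := by
  refine ⟨map_mem_closure continuous_expMap hq fun w hw => 𝒞.map_C hj hw, ?_⟩
  rw [𝒞.pullback j hj] at hq hq'
  exact notMem_of_mem_closure_component continuous_expMap (𝒞.isOpen_C (j := j + 1) hj) hq hq'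

theorem iterate_mem_closure_C {q : ℂ} (hq : q ∈ closure (𝒞.C 1)) (hq' : q ∉ 𝒞.C 1) {i : ℕ}
    (hi : i + 1 ≤ p) : (expMap lam)^[i] q ∈ closure (𝒞.C (i + 1)) ∧
      (expMap lam)^[i] q ∉ 𝒞.C (i + 1) := by
  induction i with
  | zero => exact ⟨hq, hq'⟩
  | succ i ih =>
    rw [Function.iterate_succ_apply']
    exact map_mem_closure_C (j := i + 1) (by omega) (ih (by omega)).1 (ih (by omega)).2

theorem closure_C_box (hlam : lam ≠ 0) (hp : 1 < p)
    (hz₀ : IsAttractingPeriodicPt (expMap lam) p z₀)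
    (hB : ∀ j, 1 ≤ j → j < p → ∀ z ∈ 𝒞.H (𝒞.k j), |z.im| ≤ B) {A : ℝ}
    (hA : ∀ i, 1 ≤ i → i < p → ∀ w ∈ 𝒞.enlarged B i, -A ≤ w.re) {j : ℕ} (h1 : 1 ≤ j) (h2 : j < p)
    {w : ℂ} (hw : w ∈ closure (𝒞.C j)) : -A ≤ w.re ∧ |w.im| ≤ B := by
  have hcl : IsClosed {w : ℂ | -A ≤ w.re ∧ |w.im| ≤ B} :=
    (isClosed_le continuous_const Complex.continuous_re).inter
      (isClosed_le (continuous_abs.comp Complex.continuous_im) continuous_const)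
  suffices h : 𝒞.C j ⊆ {w : ℂ | -A ≤ w.re ∧ |w.im| ≤ B} from closure_minimal h hcl hw
  refine fun u hu => ⟨?_, ?_⟩
  · refine hA (p - j) (by omega) (by omega) u (C_subset_enlarged hz₀ (Nat.sub_le _ _) ?_)
    rwa [Nat.sub_sub_self h2.le]
  · exact hB j h1 h2 u (𝒞.C_subset_H hlam hp hz₀ h1 h2 hu)

/-- Boundary points of `C 1` far to the right are mapped by `f^(p-1)` to boundary points of `C p`
with large imaginary part. -/
theorem exists_boundary_point (hlam : lam ≠ 0) (hp : 1 < p)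
    (hz₀ : IsAttractingPeriodicPt (expMap lam) p z₀)
    (hB : ∀ j, 1 ≤ j → j < p → ∀ z ∈ 𝒞.H (𝒞.k j), |z.im| ≤ B) (T : ℝ) :
    ∃ x Y : ℝ, 0 < x ∧ (⟨x, Y⟩ : ℂ) ∈ closure (𝒞.C 1) ∧ (∀ y, Y ≤ y → (⟨x, y⟩ : ℂ) ∉ 𝒞.C 1) ∧
      (expMap lam)^[p - 1] ⟨x, Y⟩ ∈ frontier (𝒞.C p) ∧
      T ≤ |((expMap lam)^[p - 1] ⟨x, Y⟩).im| := by
  obtain ⟨A, hA⟩ := exists_re_bound_enlarged hlam hp hz₀ hB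
  obtain ⟨R, hR0, hRA, hR⟩ := exists_growth hlam A B
  obtain ⟨x₀, hx₀⟩ := 𝒞.exists_top_point hlam hp hz₀
  obtain ⟨c, hc⟩ := 𝒞.isTruncatedDomain.leftHalfPlane
  obtain ⟨c', hc'⟩ := 𝒞.exists_re_le_of_mem_C_top hlam
  -- The image under f^(p-1) has modulus at least x but real part between c and c', so T + |c| +
  -- |c'| ≤ x forces height T.
  set x : ℝ := max (max x₀ R) (max 0 (T + |c| + |c'|)) + 1 with hx
  have hx1 : x₀ ≤ x := by
    have := (le_max_left x₀ R).trans (le_max_left _ (max 0 (T + |c| + |c'|))); linarith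
  have hx2 : R ≤ x := by
    have := (le_max_right x₀ R).trans (le_max_left _ (max 0 (T + |c| + |c'|))); linarith
  have hx3 : T + |c| + |c'| ≤ x := by
    have := (le_max_right 0 (T + |c| + |c'|)).trans (le_max_right (max x₀ R) _); linarith
  have hx4 : 0 < x := by
    have := (le_max_left 0 (T + |c| + |c'|)).trans (le_max_right (max x₀ R) _); linarith
  obtain ⟨Y, hY, hY'⟩ := hx₀ x hx1
  have hmem := fun (i : ℕ) (hi : i + 1 ≤ p) => iterate_mem_closure_C hY (hY' Y le_rfl) hi
  have hre : ∀ i, i + 2 ≤ p → x ≤ ((expMap lam)^[i] ⟨x, Y⟩).re := by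
    intro i hi
    induction i with
    | zero => simp
    | succ i ih =>
      have ih := ih (by omega)
      have hbox := closure_C_box hlam hp hz₀ hB hA (by omega) (by omega)
        (hmem (i + 1) (by omega)).1
      rw [Function.iterate_succ_apply'] at hbox ⊢
      have h1 := add_one_le_re_of_norm (B := B) (y := ((expMap lam)^[i] ⟨x, Y⟩).re)
        (u := expMap lam ((expMap lam)^[i] ⟨x, Y⟩))
        (by rw [norm_expMap]; exact hR _ (hx2.trans ih)) (by linarith [hbox.1]) hbox.2
      linarith
  have hfr : (expMap lam)^[p - 1] ⟨x, Y⟩ ∈ closure (𝒞.C p) ∧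
      (expMap lam)^[p - 1] ⟨x, Y⟩ ∉ 𝒞.C p := by
    have := hmem (p - 1) (by omega)
    rwa [Nat.sub_add_cancel hp.le] at this
  refine ⟨x, Y, hx4, hY, hY', ?_, ?_⟩
  · rw [(𝒞.isOpen_C le_rfl).frontier_eq]
    exact hfr
  · have h1 := hre (p - 2) (by omega)
    have h2 : x ≤ ‖(expMap lam)^[p - 1] ⟨x, Y⟩‖ := by
      rw [show p - 1 = p - 2 + 1 by omega, Function.iterate_succ_apply', norm_expMap]
      have h3 := hR _ (hx2.trans h1)
      have h4 : 0 ≤ B := (abs_nonneg _).trans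
        (hB 1 le_rfl hp _ (𝒞.kneading 1 le_rfl hp))
      linarith
    have h3 := hc' _ hfr.1
    have h4 : c ≤ ((expMap lam)^[p - 1] ⟨x, Y⟩).re := by
      by_contra! h
      exact hfr.2 (hc h)
    have h5 : |((expMap lam)^[p - 1] ⟨x, Y⟩).re| ≤ |c| + |c'| := by
      rw [abs_le]
      constructor <;> linarith [neg_abs_le c, le_abs_self c', abs_nonneg c, abs_nonneg c']
    have h6 := Complex.norm_le_abs_re_add_abs_im ((expMap lam)^[p - 1] ⟨x, Y⟩)
    linarith

/-- An inverse branch of `f^i` on a quarter-plane with values in the enlarged domains. -/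
theorem exists_inverse_branch {a T σ : ℝ} (hσ : σ = 1 ∨ σ = -1) (hT : 0 < T)
    (hTB : B < T) (hpos : ∀ i, 1 ≤ i → i < p → ∀ w : ℂ, T ≤ ‖(expMap lam)^[i] w‖ → 0 < w.re)
    (hz₀ : IsAttractingPeriodicPt (expMap lam) p z₀)
    {q : ℂ} (hq : q ∈ closure (𝒞.C 1)) (hq' : q ∉ 𝒞.C 1)
    (hu : (expMap lam)^[p - 1] q ∈ quarterPlane a T σ) {i : ℕ} (hi : i + 1 ≤ p) :
    (expMap lam)^[p - 1 - i] q ∈ 𝒞.enlarged B i ∧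
    ∃ g : ℂ → ℂ, ContinuousOn g (quarterPlane a T σ) ∧
      (∀ v ∈ quarterPlane a T σ, g v ∈ 𝒞.enlarged B i ∧ (expMap lam)^[i] (g v) = v) ∧
      g ((expMap lam)^[p - 1] q) = (expMap lam)^[p - 1 - i] q := by
  have hP : ∀ v ∈ quarterPlane a T σ, v ∈ 𝒞.enlarged B 0 := fun v hv =>
    Or.inr (hTB.trans_le (le_abs_im_of_mem_quarterPlane hσ hv))
  induction i with
  | zero => exact ⟨hP _ hu, id, continuousOn_id, fun v hv => ⟨hP v hv, rfl⟩, rfl⟩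
  | succ i ih =>
    obtain ⟨hqi, g, hg, hgv, hgu⟩ := ih (by omega)
    have hstep : expMap lam ((expMap lam)^[p - 1 - (i + 1)] q) = (expMap lam)^[p - 1 - i] q := by
      rw [← Function.iterate_succ_apply' (expMap lam)]
      congr 2
      omega
    -- The point is in the closure of the enlarged pull-back and maps into the open set below it, so
    -- it cannot be a boundary point.
    have hmem : (expMap lam)^[p - 1 - (i + 1)] q ∈ 𝒞.enlarged B (i + 1) := by
      have h1 := (iterate_mem_closure_C hq hq' (i := p - 1 - (i + 1)) (by omega)).1
      have h2 := C_subset_enlarged (𝒞 := 𝒞) (B := B) hz₀ (i := i + 1) (by omega)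
      rw [show p - 1 - (i + 1) + 1 = p - (i + 1) by omega] at h1
      by_contra h
      exact notMem_of_mem_closure_component continuous_expMap (isOpen_enlarged i)
        (closure_mono h2 h1) h (hstep ▸ hqi)
    -- At i = 0 the height keeps v off the slit. Later, a large f^i-image forces a positive real
    -- part.
    have hsl : ∀ v ∈ quarterPlane a T σ, g v ∈ Complex.slitPlane := by
      intro v hv
      have hTv := le_abs_im_of_mem_quarterPlane hσ hv
      rcases Nat.eq_zero_or_pos i with rfl | h0
      · have h1 : g v = v := (hgv v hv).2
        rw [h1]
        refine Complex.mem_slitPlane_iff.2 (Or.inr fun h => ?_)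
        rw [h, abs_zero] at hTv
        linarith
      · refine Complex.mem_slitPlane_iff.2 (Or.inl (hpos i h0 (by omega) _ ?_))
        rw [(hgv v hv).2]
        exact hTv.trans (Complex.abs_im_le_norm v)
    have hne : ∀ v ∈ quarterPlane a T σ, g v ≠ 0 := fun v hv =>
      Complex.slitPlane_ne_zero (hsl v hv)
    refine ⟨hmem, fun v => (expMap lam)^[p - 1 - (i + 1)] q +
      (Complex.log (g v) - Complex.log (g ((expMap lam)^[p - 1] q))), ?_, ?_, by simp⟩
    · exact continuousOn_const.add ((hg.clog hsl).sub continuousOn_const)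
    · have hf : ∀ v ∈ quarterPlane a T σ, expMap lam ((expMap lam)^[p - 1 - (i + 1)] q +
          (Complex.log (g v) - Complex.log (g ((expMap lam)^[p - 1] q)))) = g v := by
        intro v hv
        rw [expMap_add, Complex.exp_sub, Complex.exp_log (hne v hv), Complex.exp_log (hne _ hu),
          hstep, ← hgu, mul_div_cancel₀ _ (hne _ hu)]
      intro v hv
      refine ⟨lift_subset_component (convex_quarterPlane a T σ).isPreconnected
        (g := fun v => (expMap lam)^[p - 1 - (i + 1)] q +
          (Complex.log (g v) - Complex.log (g ((expMap lam)^[p - 1] q))))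
        (continuousOn_const.add ((hg.clog hsl).sub continuousOn_const))
        (fun v hv => ?_) hu ?_ v hv, ?_⟩
      · rw [hf v hv]
        exact (hgv v hv).1
      · simp only [sub_self, add_zero]
        exact hmem
      · rw [Function.iterate_succ_apply, hf v hv]
        exact (hgv v hv).2

theorem exists_return_branch (hlam : lam ≠ 0) (hp : 1 < p)
    (hz₀ : IsAttractingPeriodicPt (expMap lam) p z₀)
    (hB : ∀ j, 1 ≤ j → j < p → ∀ z ∈ 𝒞.H (𝒞.k j), |z.im| ≤ B) :
    ∃ (a T σ : ℝ) (G : ℂ → ℂ), 0 < T ∧ (σ = 1 ∨ σ = -1) ∧ ContinuousOn G (quarterPlane a T σ) ∧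
      (∀ v ∈ quarterPlane a T σ, G v ∈ 𝒞.enlarged B (p - 1) ∧ 0 < (G v).re ∧
        (expMap lam)^[p - 1] (G v) = v) ∧
      ∀ m : ℤ, ∃ s : ℤ, ∀ v ∈ quarterPlane a T σ,
        Complex.log (G v) - Complex.log lam + 2 * (Real.pi : ℂ) * Complex.I * (m : ℂ) ∈ 𝒞.H s := by
  obtain ⟨V, hV⟩ := exists_norm_iterate_le_of_lt lam 0 p
  set T : ℝ := max (max B V) (max 𝒞.L₂ 0) + 1 with hT
  have hTB : B < T := by
    have := (le_max_left B V).trans (le_max_left _ (max 𝒞.L₂ 0)); linarith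
  have hTV : V < T := by
    have := (le_max_right B V).trans (le_max_left _ (max 𝒞.L₂ 0)); linarith
  have hTL : 𝒞.L₂ < T := by
    have := (le_max_left 𝒞.L₂ 0).trans (le_max_right (max B V) _); linarith
  have hT0 : 0 < T := by
    have := (le_max_right 𝒞.L₂ 0).trans (le_max_right (max B V) _); linarith
  have hpos : ∀ i, 1 ≤ i → i < p → ∀ w : ℂ, T ≤ ‖(expMap lam)^[i] w‖ → 0 < w.re := by
    intro i h1 h2 w hw
    by_contra! h
    linarith [hV i h1 h2 w h]
  obtain ⟨x, Y, hx, hY, hY', hfr, him⟩ := exists_boundary_point hlam hp hz₀ hB T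
  obtain ⟨σ, hσ, hσT⟩ : ∃ σ : ℝ, (σ = 1 ∨ σ = -1) ∧
      T ≤ σ * ((expMap lam)^[p - 1] ⟨x, Y⟩).im := by
    rcases le_abs.1 him with h | h
    · exact ⟨1, Or.inl rfl, by rwa [one_mul]⟩
    · exact ⟨-1, Or.inr rfl, by rwa [neg_one_mul]⟩
  obtain ⟨a, hdisj, hmem⟩ := 𝒞.exists_quarterPlane_disjoint hlam hσ hTL
  have hu := hmem _ hfr hσT
  obtain ⟨-, G, hG, hGv, hGu⟩ := exists_inverse_branch (B := B) hσ hT0 hTB hpos hz₀ hY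
    (hY' Y le_rfl) hu (i := p - 1) (by omega)
  rw [Nat.sub_self, Function.iterate_zero, id] at hGu
  have hGre : ∀ v ∈ quarterPlane a T σ, 0 < (G v).re := fun v hv =>
    hpos (p - 1) (by omega) (by omega) _ (by
      rw [(hGv v hv).2]
      exact (le_abs_im_of_mem_quarterPlane hσ hv).trans (Complex.abs_im_le_norm v))
  refine ⟨a, T, σ, G, hT0, hσ, hG, fun v hv => ⟨(hGv v hv).1, hGre v hv, (hGv v hv).2⟩,
    fun m => ?_⟩
  -- The vertical ray above the top point avoids `C 1`, so its logarithmic lift avoids `C 0`. The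
  -- lift reaches points with images of large height, which lie in some `H s`.
  have hbase : ∃ s, Complex.log (⟨x, Y⟩ : ℂ) - Complex.log lam +
      2 * (Real.pi : ℂ) * Complex.I * (m : ℂ) ∈ 𝒞.H s := by
    let h : ℝ → ℂ := fun t => Complex.log (⟨x, Y⟩ + t * Complex.I) - Complex.log lam +
      2 * (Real.pi : ℂ) * Complex.I * (m : ℂ)
    have hsl : ∀ t : ℝ, (⟨x, Y⟩ + t * Complex.I : ℂ) ∈ Complex.slitPlane := fun t =>
      Complex.mem_slitPlane_iff.2 (Or.inl (by simpa using hx))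
    have hf : ∀ t, expMap lam (h t) = ⟨x, Y⟩ + t * Complex.I := fun t =>
      expMap_log hlam (Complex.slitPlane_ne_zero (hsl t)) m
    have hcont : Continuous h :=
      ((Continuous.clog (by fun_prop) hsl).sub continuous_const).add continuous_const
    obtain ⟨s, hs⟩ := exists_mem_H_of_lt_abs_im hlam hp hz₀ hB (u := h (|Y| + |B| + 1)) (by
      rw [hf]
      simp only [Complex.add_im, Complex.mul_im, Complex.ofReal_re, Complex.I_im, Complex.ofReal_im,
        Complex.I_re]
      refine lt_of_lt_of_le ?_ (le_abs_self _)
      linarith [neg_abs_le Y, le_abs_self B])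
    refine ⟨s, ?_⟩
    have hsub := 𝒞.subset_H hlam hp hz₀ (X := h '' Ici 0)
      (isPreconnected_Ici.image h hcont.continuousOn) (by
        rw [disjoint_left]
        rintro _ ⟨t, ht, rfl⟩
        rw [𝒞.C_zero_eq hlam hp hz₀, mem_preimage, hf]
        have ht' : (0 : ℝ) ≤ t := ht
        have h2 : (⟨x, Y⟩ + t * Complex.I : ℂ) = ⟨x, Y + t⟩ := by apply Complex.ext <;> simp
        rw [h2]
        exact hY' _ (by linarith)) ⟨_, show (0 : ℝ) ≤ |Y| + |B| + 1 by positivity, rfl⟩ hs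
    have h0 : h 0 = Complex.log (⟨x, Y⟩ : ℂ) - Complex.log lam +
        2 * (Real.pi : ℂ) * Complex.I * (m : ℂ) := by simp [h]
    rw [← h0]
    exact hsub ⟨0, self_mem_Ici, rfl⟩
  obtain ⟨s, hs⟩ := hbase
  refine ⟨s, fun v hv => ?_⟩
  rw [← hGu] at hs
  refine 𝒞.subset_H hlam hp hz₀ (X := (fun v => Complex.log (G v) - Complex.log lam +
      2 * (Real.pi : ℂ) * Complex.I * (m : ℂ)) '' quarterPlane a T σ)
    ((convex_quarterPlane a T σ).isPreconnected.image _
      (((hG.clog fun v hv => Complex.mem_slitPlane_iff.2 (Or.inl (hGre v hv))).sub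
        continuousOn_const).add continuousOn_const)) ?_ (mem_image_of_mem _ hu) hs
    (mem_image_of_mem _ hv)
  -- If G w were in `C 1`, then w = f^(p-1)(G w) would be in `C p`, which the quarter-plane misses.
  rw [disjoint_left]
  rintro _ ⟨w, hw, rfl⟩
  rw [𝒞.C_zero_eq hlam hp hz₀, mem_preimage,
    expMap_log hlam (fun h => by have := hGre w hw; rw [h] at this; simp at this)]
  intro h1
  have h2 := 𝒞.iterate_C (i := p - 1) (by omega) h1
  rw [(hGv w hw).2, show 1 + (p - 1) = p by omega] at h2
  exact disjoint_left.1 hdisj hw h2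

end Construction

end ReturnBranch

/-! ### Orbits that follow an inverse branch -/

section Dynamics

/-- Iterates of a curve under a map `Φ`, pushed to the right of the line `Re = R`. -/
noncomputable def pushedCurve (Φ : ℂ → ℂ) (R y : ℝ) : ℕ → ℝ → ℂ
  | 0, t => (max t R : ℝ) + y * Complex.I
  | n + 1, t => (max (Φ (pushedCurve Φ R y n t)).re R : ℝ) +
      (Φ (pushedCurve Φ R y n t)).im * Complex.I

theorem pushedCurve_succ_eq {Φ : ℂ → ℂ} {R y t : ℝ} {n : ℕ}
    (h : R < (pushedCurve Φ R y (n + 1) t).re) :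
    pushedCurve Φ R y (n + 1) t = Φ (pushedCurve Φ R y n t) := by
  simp only [pushedCurve, Complex.add_re, Complex.ofReal_re, Complex.mul_re, Complex.I_re,
    mul_zero, Complex.ofReal_im, Complex.I_im, mul_one, sub_zero, add_zero, lt_sup_iff,
    lt_self_iff_false, or_false] at h ⊢
  rw [max_eq_left h.le, Complex.re_add_im]

/-- Suppose that `Φ` is a continuous inverse branch of `F` on `P` with values in a horizontal strip,
which decreases real parts by at least `1`. Then on every vertical line far to the right there is
a point whose whole orbit under `F` is obtained from the branch `Φ`. -/
theorem exists_orbit_of_branch {F Φ : ℂ → ℂ} (hF : Continuous F) {P : Set ℂ} (hP : IsClosed P)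
    {R y b : ℝ} (hPR : ∀ z ∈ P, ∀ x : ℝ, R ≤ x → (x : ℂ) + z.im * Complex.I ∈ P)
    (hy : (R : ℂ) + y * Complex.I ∈ P) (hyb : |y| ≤ b) (hΦ : ContinuousOn Φ P)
    (hΦP : ∀ v ∈ P, (R : ℂ) + (Φ v).im * Complex.I ∈ P ∧ |(Φ v).im| ≤ b)
    (hFΦ : ∀ v ∈ P, F (Φ v) = v)
    (hgrow : ∀ v ∈ P, R ≤ v.re → |v.im| ≤ b → R ≤ (Φ v).re → (Φ v).re + 1 ≤ v.re)
    (hlim : ∀ K : ℝ, ∃ V : ℝ, ∀ w : ℂ, w.re ≤ K → ‖F w‖ ≤ V) {x : ℝ} (hx : R < x) :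
    ∃ z : ℂ, z.re = x ∧ ∀ j : ℕ, F^[j + 1] z ∈ P ∧ F^[j] z = Φ (F^[j + 1] z) ∧
      x + j ≤ (F^[j] z).re := by
  set c := pushedCurve Φ R y with hc
  have hre0 : ∀ t, (c 0 t).re = max t R := fun t => by simp [hc, pushedCurve]
  have him0 : ∀ t, (c 0 t).im = y := fun t => by simp [hc, pushedCurve]
  have hre : ∀ n t, (c (n + 1) t).re = max (Φ (c n t)).re R := fun n t => by
    simp [hc, pushedCurve]
  have him : ∀ n t, (c (n + 1) t).im = (Φ (c n t)).im := fun n t => by simp [hc, pushedCurve]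
  have hmem : ∀ n t, c n t ∈ P ∧ R ≤ (c n t).re ∧ |(c n t).im| ≤ b := by
    intro n t
    induction n with
    | zero =>
      refine ⟨?_, by rw [hre0]; exact le_max_right _ _, by rwa [him0]⟩
      have h := hPR _ hy (max t R) (le_max_right _ _)
      simpa [hc, pushedCurve] using h
    | succ n ih =>
      obtain ⟨h1, h2⟩ := hΦP _ ih.1
      refine ⟨?_, by rw [hre]; exact le_max_right _ _, by rwa [him]⟩
      have h := hPR _ h1 (max (Φ (c n t)).re R) (le_max_right _ _)
      simpa [hc, pushedCurve] using h
  have hcont : ∀ n, Continuous (c n) := by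
    intro n
    induction n with
    | zero => simp only [hc, pushedCurve]; fun_prop
    | succ n ih =>
      have h1 : Continuous fun t => Φ (c n t) := hΦ.comp_continuous ih fun t => (hmem n t).1
      change Continuous fun t => ((max (Φ (c n t)).re R : ℝ) : ℂ) + (Φ (c n t)).im * Complex.I
      exact (Complex.continuous_ofReal.comp
        ((Complex.continuous_re.comp h1).max continuous_const)).add
        ((Complex.continuous_ofReal.comp (Complex.continuous_im.comp h1)).mul continuous_const)
  -- The left end never leaves the line Re = R, since Φ lowers real parts; with the right end at
  -- infinity, every curve crosses Re = x.
  have hleft : ∀ n, (c n R).re = R := by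
    intro n
    induction n with
    | zero => rw [hre0, max_self]
    | succ n ih =>
      rw [hre]
      refine max_eq_right ?_
      by_contra! h
      have := hgrow _ (hmem n R).1 (hmem n R).2.1 (hmem n R).2.2 h.le
      linarith
  have htop : ∀ n, Tendsto (fun t => (c n t).re) atTop atTop := by
    intro n
    induction n with
    | zero =>
      simp only [hre0]
      exact tendsto_atTop_mono (fun t => le_max_left t R) tendsto_id
    | succ n ih =>
      refine tendsto_atTop.2 fun K => ?_
      obtain ⟨V, hV⟩ := hlim K
      filter_upwards [ih.eventually_gt_atTop V] with t ht
      rw [hre]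
      refine le_max_of_le_left ?_
      by_contra! h
      have h1 := hV _ h.le
      rw [hFΦ _ (hmem n t).1] at h1
      linarith [Complex.re_le_norm (c n t)]
  have hstep : ∀ n t, R < (c (n + 1) t).re → c (n + 1) t = Φ (c n t) ∧
      F (c (n + 1) t) = c n t ∧ (c (n + 1) t).re + 1 ≤ (c n t).re := by
    intro n t h
    have h1 : c (n + 1) t = Φ (c n t) := pushedCurve_succ_eq h
    refine ⟨h1, by rw [h1]; exact hFΦ _ (hmem n t).1, ?_⟩
    rw [h1] at h ⊢
    exact hgrow _ (hmem n t).1 (hmem n t).2.1 (hmem n t).2.2 h.le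
  -- Real parts increase along F, so a point that ends to the right of R was never pushed at an
  -- earlier stage.
  have hchain : ∀ n t, R < (c n t).re → ∀ j, j ≤ n → F^[j] (c n t) = c (n - j) t ∧
      (c n t).re + j ≤ (c (n - j) t).re := by
    intro n t h j hj
    induction j with
    | zero => simp
    | succ j ih =>
      obtain ⟨h1, h2⟩ := ih (by omega)
      obtain ⟨k, hk⟩ : ∃ k, n - j = k + 1 := ⟨n - j - 1, by omega⟩
      rw [hk] at h1 h2
      have hj0 : (0 : ℝ) ≤ j := j.cast_nonneg
      obtain ⟨-, h3, h4⟩ := hstep k t (by linarith)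
      rw [Function.iterate_succ_apply', h1, h3, show n - (j + 1) = k by omega]
      refine ⟨rfl, ?_⟩
      push_cast
      linarith
  have hex : ∀ n, ∃ t, (c n t).re = x := fun n =>
    mem_range_of_exists_le_of_exists_ge (Complex.continuous_re.comp (hcont n))
      ⟨R, (hleft n).le.trans hx.le⟩ ((htop n).eventually_ge_atTop x).exists
  choose t ht using hex
  have hcpt : ∀ n, c n (t n) ∈ Metric.closedBall (0 : ℂ) (|x| + b) := by
    intro n
    rw [mem_closedBall_zero_iff]
    refine (Complex.norm_le_abs_re_add_abs_im _).trans ?_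
    rw [ht]
    exact add_le_add le_rfl (hmem n (t n)).2.2
  -- The n-th point follows Φ for n steps, so a limit point follows it forever.
  obtain ⟨z, -, φ, hφ, hz⟩ := (isCompact_closedBall (0 : ℂ) (|x| + b)).tendsto_subseq hcpt
  have hzj : ∀ j, Tendsto (fun n => F^[j] (c (φ n) (t (φ n)))) atTop (𝓝 (F^[j] z)) := fun j =>
    ((hF.iterate j).tendsto z).comp hz
  have hev : ∀ j, ∀ᶠ n in atTop, F^[j] (c (φ n) (t (φ n))) = c (φ n - j) (t (φ n)) ∧
      x + j ≤ (c (φ n - j) (t (φ n))).re ∧ j + 1 ≤ φ n := by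
    intro j
    filter_upwards [hφ.tendsto_atTop.eventually_ge_atTop (j + 1)] with n hn
    have h1 := hchain (φ n) (t (φ n)) (by rw [ht]; exact hx) j (by omega)
    rw [ht] at h1
    exact ⟨h1.1, h1.2, hn⟩
  have hPj : ∀ j, F^[j] z ∈ P := fun j => hP.mem_of_tendsto (hzj j) <| by
    filter_upwards [hev j] with n hn
    rw [hn.1]
    exact (hmem _ _).1
  refine ⟨z, ?_, fun j => ⟨hPj _, ?_, ?_⟩⟩
  · have h1 := (Complex.continuous_re.tendsto z).comp hz
    refine tendsto_nhds_unique h1 (tendsto_const_nhds.congr fun n => ?_)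
    exact (ht (φ n)).symm
  · have h1 : Tendsto (fun n => Φ (F^[j + 1] (c (φ n) (t (φ n))))) atTop
        (𝓝 (Φ (F^[j + 1] z))) := by
      refine (hΦ _ (hPj (j + 1))).tendsto.comp
        (tendsto_nhdsWithin_iff.2 ⟨hzj (j + 1), ?_⟩)
      filter_upwards [hev (j + 1)] with n hn
      rw [hn.1]
      exact (hmem _ _).1
    refine tendsto_nhds_unique (hzj j) (h1.congr' ?_)
    filter_upwards [hev j, hev (j + 1)] with n hn hn'
    obtain ⟨k, hk⟩ : ∃ k, φ n - j = k + 1 := ⟨φ n - j - 1, by omega⟩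
    have hj0 : (0 : ℝ) ≤ j := j.cast_nonneg
    rw [hn'.1, hn.1, hk, show φ n - (j + 1) = k by omega]
    rw [hk] at hn
    exact (hstep k _ (by linarith [hn.2.1])).1.symm
  · have h1 := (Complex.continuous_re.tendsto _).comp (hzj j)
    refine ge_of_tendsto h1 ?_
    filter_upwards [hev j] with n hn
    simp only [Function.comp_apply]
    rw [hn.1]
    exact hn.2.1

end Dynamics

/-! ### The lower bound -/

section LowerBound

variable {lam : ℂ} {p : ℕ} {z₀ : ℂ}

theorem Construction.exists_point_on_line (𝒞 : Construction (expMap lam) p z₀) (hlam : lam ≠ 0)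
    (hp : 1 < p) (hz₀ : IsAttractingPeriodicPt (expMap lam) p z₀) : ∃ R : ℝ, ∀ x, R < x →
      ∃ z : ℂ, z.re = x ∧ (∃ s ∈ kneadingSequences p 𝒞.k, HasItinerary (expMap lam) 𝒞.H z s) ∧
        z ∈ escapingSet (expMap lam) := by
  obtain ⟨B, hB⟩ := 𝒞.exists_im_bound_kneading hlam hp hz₀
  obtain ⟨A, hA⟩ := exists_re_bound_enlarged hlam hp hz₀ hB
  obtain ⟨a, T, σ, G, hT, hσ, hG, hGv, hGH⟩ := exists_return_branch hlam hp hz₀ hB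
  have hpi := Real.pi_gt_three
  have hσ2 : σ * σ = 1 := by rcases hσ with rfl | rfl <;> norm_num
  have hσa : |σ| = 1 := by rcases hσ with rfl | rfl <;> norm_num
  -- Shifting the logarithm by 2πσN puts its values at height at least 2π(N-1) ≥ T on the σ-side, so
  -- Φ can be iterated once real parts are pushed beyond a.
  obtain ⟨N, hN⟩ := exists_nat_ge (T + 1)
  obtain ⟨m, hm⟩ : ∃ m : ℤ, (m : ℝ) = σ * N := by
    rcases hσ with rfl | rfl
    · exact ⟨N, by simp⟩
    · exact ⟨-N, by simp⟩
  obtain ⟨s, hs⟩ := hGH m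
  set P := quarterPlane a T σ with hPdef
  set Φ : ℂ → ℂ := fun v => Complex.log (G v) - Complex.log lam +
    2 * (Real.pi : ℂ) * Complex.I * (m : ℂ) with hΦdef
  set b : ℝ := 2 * Real.pi * N + 2 * Real.pi with hb
  -- One threshold serves both strips: B for the intermediate times of a turn, b for the return to
  -- the values of Φ.
  obtain ⟨R, hR0, hRA, hR⟩ := exists_growth hlam (max A a) (max B b)
  have hRA' : A ≤ R := (le_max_left _ _).trans hRA
  have hRa : a ≤ R := (le_max_right _ _).trans hRA
  have hG0 : ∀ v ∈ P, G v ≠ 0 := fun v hv h => by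
    have := (hGv v hv).2.1; rw [h] at this; simp at this
  have hfΦ : ∀ v ∈ P, expMap lam (Φ v) = G v := fun v hv => expMap_log hlam (hG0 v hv) m
  have hFΦ : ∀ v ∈ P, (expMap lam)^[p] (Φ v) = v := fun v hv => by
    rw [← Nat.sub_add_cancel hp.le, Function.iterate_succ_apply, hfΦ v hv]
    exact (hGv v hv).2.2
  have hΦim : ∀ v, (Φ v).im = (G v).arg - lam.arg + 2 * Real.pi * (σ * N) := fun v => by
    rw [← hm]; simp [hΦdef, Complex.log_im]
  have hΦcont : ContinuousOn Φ P :=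
    ((hG.clog fun v hv => Complex.mem_slitPlane_iff.2 (Or.inl (hGv v hv).2.1)).sub
      continuousOn_const).add continuousOn_const
  have hdiff : ∀ v, |(G v).arg - lam.arg| ≤ 2 * Real.pi := fun v => by
    have h1 := abs_le.1 (Complex.abs_arg_le_pi (G v))
    have h2 := abs_le.1 (Complex.abs_arg_le_pi lam)
    rw [abs_le]; constructor <;> linarith
  have hN0 : (0 : ℝ) ≤ N := N.cast_nonneg
  have hΦb : ∀ v, |(Φ v).im| ≤ b := fun v => by
    rw [hΦim, hb, add_comm (2 * Real.pi * (N : ℝ))]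
    refine (abs_add_le _ _).trans (add_le_add (hdiff v) ?_)
    rw [abs_mul, abs_mul σ, hσa, one_mul, abs_of_pos Real.two_pi_pos, abs_of_nonneg hN0]
  have hΦT : ∀ v, T ≤ σ * (Φ v).im := fun v => by
    have h1 : σ * (Φ v).im = σ * ((G v).arg - lam.arg) + 2 * Real.pi * N := by
      rw [hΦim]; linear_combination (2 * Real.pi * N) * hσ2
    have h2 : |σ * ((G v).arg - lam.arg)| ≤ 2 * Real.pi := by
      rw [abs_mul, hσa, one_mul]; exact hdiff v
    have h3 := (abs_le.1 h2).1
    rw [h1]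
    nlinarith
  -- growth along one turn of the cycle
  have horbit : ∀ v ∈ P, ∀ i, i + 1 < p →
      (expMap lam)^[i + 1] (Φ v) ∈ 𝒞.enlarged B (p - (i + 1)) := by
    intro v hv i hi
    induction i with
    | zero => rw [zero_add, Function.iterate_one, hfΦ v hv]; exact (hGv v hv).1
    | succ i ih =>
      rw [Function.iterate_succ_apply']
      refine map_enlarged ?_
      rw [show p - (i + 1 + 1) + 1 = p - (i + 1) by omega]
      exact ih (by omega)
  have hH : ∀ v ∈ P, ∀ i, i + 1 < p → (expMap lam)^[i + 1] (Φ v) ∈ 𝒞.H (𝒞.k (i + 1)) := by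
    intro v hv i hi
    have := enlarged_subset_H hlam hp hz₀ hB (by omega) (by omega) (horbit v hv i hi)
    rwa [Nat.sub_sub_self hi.le] at this
  have hturn : ∀ v ∈ P, R ≤ (Φ v).re → ∀ i, i < p →
      (Φ v).re ≤ ((expMap lam)^[i] (Φ v)).re := by
    intro v hv hvR i hi
    induction i with
    | zero => simp
    | succ i ih =>
      have ih := ih (by omega)
      have h1 := hR _ (hvR.trans ih)
      rw [← norm_expMap, ← Function.iterate_succ_apply' (expMap lam)] at h1
      have h2 := add_one_le_re_of_norm (B := B) ((add_le_add le_rfl (le_max_left B b)).trans h1)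
        (by linarith [hA _ (by omega) (by omega) _ (horbit v hv i hi)])
        (hB _ (by omega) hi _ (hH v hv i hi))
      linarith
  have hgrow : ∀ v ∈ P, R ≤ v.re → |v.im| ≤ b → R ≤ (Φ v).re → (Φ v).re + 1 ≤ v.re := by
    intro v hv hv1 hv2 hv3
    have h1 := hturn v hv hv3 (p - 1) (by omega)
    have h2 := hR _ (hv3.trans h1)
    rw [← norm_expMap, ← Function.iterate_succ_apply' (expMap lam),
      show (p - 1).succ = p by omega, hFΦ v hv] at h2
    have h3 := add_one_le_re_of_norm (B := b) ((add_le_add le_rfl (le_max_right B b)).trans h2)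
      (by linarith) hv2
    linarith
  refine ⟨R, fun x hx => ?_⟩
  obtain ⟨z, hzx, hz⟩ := exists_orbit_of_branch (F := (expMap lam)^[p]) (Φ := Φ) (P := P) (R := R)
    (y := σ * T) (b := b) (continuous_expMap_iterate p) (isClosed_quarterPlane a T σ)
    (fun z hz y hy => ⟨by simpa using hRa.trans hy, by simpa using hz.2⟩)
    ⟨by simpa using hRa, by simp [← mul_assoc, hσ2]⟩
    (by rw [abs_mul, hσa, one_mul, abs_of_pos hT]; nlinarith) hΦcont
    (fun v hv => ⟨⟨by simpa using hRa, by simpa using hΦT v⟩, hΦb v⟩) hFΦ hgrow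
    (fun K => by
      have := exists_norm_iterate_le lam K (p - 1)
      rwa [Nat.sub_add_cancel hp.le] at this) hx
  have hit : ∀ j, (expMap lam)^[p * j] z = Φ (((expMap lam)^[p])^[j + 1] z) := fun j => by
    rw [Function.iterate_mul]; exact (hz j).2.1
  have hsplit : ∀ j i, (expMap lam)^[j * p + i] z =
      (expMap lam)^[i] (Φ (((expMap lam)^[p])^[j + 1] z)) := fun j i => by
    rw [← hit, ← Function.iterate_add_apply, add_comm, mul_comm]
  have hdm : ∀ n, n / p * p + n % p = n := fun n => Nat.div_add_mod' n p
  -- The free entries t_l are all equal to s, because the same branch is used on every turn.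
  refine ⟨z, hzx, ⟨fun n => if n % p = 0 then s else 𝒞.k (n % p), ⟨fun _ => s, fun l => ⟨?_, ?_⟩⟩,
    fun n => ?_⟩, ?_⟩
  · simp
  · intro j hj1 hj2
    have h1 : (l * p + j) % p = j := by
      rw [Nat.mul_add_mod', Nat.mod_eq_of_lt hj2]
    simp only [h1]
    rw [if_neg (by omega)]
  · have h1 := hsplit (n / p) (n % p)
    rw [hdm] at h1
    have h2 : n % p < p := Nat.mod_lt _ (by omega)
    rw [h1]
    by_cases h : n % p = 0
    · simp only [h, if_true, Function.iterate_zero, id]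
      exact hs _ (hz _).1
    · simp only [h, if_false]
      obtain ⟨i, hi⟩ := Nat.exists_eq_succ_of_ne_zero h
      rw [hi] at h2 ⊢
      exact hH _ (hz _).1 i h2
  · have hlow : ∀ n : ℕ, x + (n / p : ℕ) ≤ ‖(expMap lam)^[n] z‖ := by
      intro n
      have h1 := hsplit (n / p) (n % p)
      rw [hdm] at h1
      have h2 := (hz (n / p)).2.2
      rw [(hz (n / p)).2.1] at h2
      have h0 : (0 : ℝ) ≤ (n / p : ℕ) := Nat.cast_nonneg _
      have h3 := hturn _ (hz (n / p)).1 (by linarith) (n % p) (Nat.mod_lt _ (by omega))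
      rw [h1]
      exact h2.trans (h3.trans (Complex.re_le_norm _))
    change Tendsto _ _ _
    rw [← tendsto_norm_atTop_iff_cobounded]
    refine tendsto_atTop_mono hlow (tendsto_atTop_add_const_left _ x ?_)
    exact tendsto_natCast_atTop_atTop.comp (Nat.tendsto_div_const_atTop (by omega))

end LowerBound

end ExpBasin

theorem mainTheorem4 (lam : ℂ) (hlam : lam ≠ 0) (p : ℕ) (hp : 1 < p) (z₀ : ℂ)
    (hz₀ : ExpBasin.IsAttractingPeriodicPt (ExpBasin.expMap lam) p z₀)
    (𝒞 : ExpBasin.Construction (ExpBasin.expMap lam) p z₀) :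
    dimH ({z : ℂ | z ∈ ExpBasin.juliaSet (ExpBasin.expMap lam) ∧
        ∃ s ∈ ExpBasin.kneadingSequences p 𝒞.k,
          ExpBasin.HasItinerary (ExpBasin.expMap lam) 𝒞.H z s} ∩
      ExpBasin.escapingSet (ExpBasin.expMap lam)) = 1 := by
  refine le_antisymm ((dimH_mono ?_).trans (𝒞.dimH_le_one hlam hp hz₀)) ?_
  · exact inter_subset_inter_left _ fun z hz => hz.2
  · obtain ⟨R, hR⟩ := 𝒞.exists_point_on_line hlam hp hz₀
    have h1 : dimH (Ioi R) = 1 := by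
      simpa using Real.dimH_of_nonempty_interior (s := Ioi R)
        (by rw [interior_Ioi]; exact nonempty_Ioi)
    -- The real parts of the set contain a ray, and Re is 1-Lipschitz.
    refine h1.ge.trans ((dimH_mono ?_).trans
      (LipschitzWith.dimH_image_le (f := Complex.re) (K := 1) ?_ _))
    · intro x hx
      obtain ⟨z, hzx, hit, hesc⟩ := hR x hx
      exact ⟨z, ⟨⟨ExpBasin.escapingSet_subset_juliaSet hlam hesc, hit⟩, hesc⟩, hzx⟩
    · exact LipschitzWith.of_dist_le_mul fun u v => by
        rw [NNReal.coe_one, one_mul, Real.dist_eq, dist_eq_norm, ← Complex.sub_re]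
        exact Complex.abs_re_le_norm _
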